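/- **2-Disjoint Connected Subgraphs** is the following decision problem. *Input:* a connected simple undirected graph $G=(V,E)$ and two disjoint sets of terminal vertices $Z_1,Z_2\subseteq V$. *Question:* does there exist a partition $A_1,A_2$ of $V$ with $Z_1\subseteq A_1$, $Z_2\subseteq A_2$ such that the induced subgraphs $G[A_1]$ and $G[A_2]$ are both connected? (A graph is called connected if any two of its vertices are joined by a path, so the graph without vertices counts as connected; a part of the partition may be empty.) **Theorem.** There is a polynomial-space algorithm that solves 2-Disjoint Connected Subgraphs in time $O^*(1.7804^n)$, where $n=|V|$. That is, there are a single program $P$ and polynomials $p,q$ such that for every input $(G,Z_1,Z_2)$ with $V=\{0,\dots,n-1\}$, the program $P$, started on the adjacency matrix of $G$ and the indicator vectors of $Z_1$ and $Z_2$, halts with output $1$ if the answer is yes and with output $0$ if the answer is no, within time $p(n)\cdot 1.7804^n$ and space $q(n)$. Here programs are deterministic random access programs: built from assignments to cells of finitely many arrays of natural numbers, sequential composition, branching and while loops, with expressions formed from constants, array cells (with computed index), addition, truncated subtraction, multiplication, division with remainder and comparisons. Time is logarithmic cost (each operation costs one plus the bit lengths of the numbers and addresses it handles), and space is the largest total bit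 length, over the course of the computation, of the nonzero memory cells and their addresses. -/

import Mathlib

/-! ### The decision problem -/

namespace SimpleGraph

/-- `G[A]` is connected: any two vertices of `A` are joined by a path in `G[A]`.
(The graph without vertices counts as connected.) -/
def ConnectedOn {V : Type*} (G : SimpleGraph V) (A : Set V) : Prop :=
  (G.induce A).Preconnected

/-- The question of 2-Disjoint Connected Subgraphs: is there a partition `A₁, A₂` of the vertex
set with `Z₁ ⊆ A₁`, `Z₂ ⊆ A₂` and `G[A₁]`, `G[A₂]` both connected? -/
def TwoDisjointConnected {V : Type*} (G : SimpleGraph V) (Z₁ Z₂ : Set V) : Prop :=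
  ∃ A₁ A₂ : Set V, Disjoint A₁ A₂ ∧ A₁ ∪ A₂ = Set.univ ∧ Z₁ ⊆ A₁ ∧ Z₂ ⊆ A₂ ∧
    G.ConnectedOn A₁ ∧ G.ConnectedOn A₂

theorem ConnectedOn.insert_of_adj {V : Type*} {G : SimpleGraph V} {A : Set V} (h : G.ConnectedOn A)
    {x y : V} (hx : x ∈ A) (hxy : G.Adj x y) : G.ConnectedOn (insert y A) := by
  have key : ∀ a : (insert y A : Set V), (G.induce (insert y A)).Reachable a ⟨x, Or.inr hx⟩ := by
    rintro ⟨a, rfl | ha⟩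
    · exact SimpleGraph.Adj.reachable (by simpa using hxy.symm)
    · exact (h ⟨a, ha⟩ ⟨x, hx⟩).map (SimpleGraph.induceHomOfLE G (Set.subset_insert y A)).toHom
  exact fun a b => (key a).trans (key b).symm

/-- In a connected graph it makes no difference whether `A₁, A₂` is asked to be a partition of the
vertex set or only a pair of disjoint sets. -/
theorem twoDisjointConnected_iff {V : Type*} [Finite V] (G : SimpleGraph V)
    (hG : G.Preconnected) (Z₁ Z₂ : Set V) :
    G.TwoDisjointConnected Z₁ Z₂ ↔ ∃ A₁ A₂ : Set V, Disjoint A₁ A₂ ∧ Z₁ ⊆ A₁ ∧ Z₂ ⊆ A₂ ∧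
      G.ConnectedOn A₁ ∧ G.ConnectedOn A₂ := by
  constructor
  · rintro ⟨A, B, h, -, h'⟩; exact ⟨A, B, h, h'⟩
  rintro ⟨A, B, h⟩
  generalize hm : (A ∪ B)ᶜ.ncard = m
  induction m using Nat.strong_induction_on generalizing A B with
  | _ m ih =>
  obtain ⟨hd, hA, hB, cA, cB⟩ := h
  by_cases hu : A ∪ B = Set.univ
  · exact ⟨A, B, hd, hu, hA, hB, cA, cB⟩
  rcases (A ∪ B).eq_empty_or_nonempty with he | hne
  · obtain ⟨rfl, rfl⟩ := Set.union_empty_iff.1 he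
    refine ⟨∅, Set.univ, by simp, by simp, hA, by simp, cA, ?_⟩
    rintro ⟨a, -⟩ ⟨b, -⟩
    exact (hG a b).map (SimpleGraph.induceUnivIso G).symm.toHom
  · obtain ⟨a, ha⟩ := hne
    obtain ⟨b, hb⟩ := (Set.ne_univ_iff_exists_notMem _).1 hu
    obtain ⟨p⟩ := hG a b
    obtain ⟨d, -, h1, h2⟩ := p.exists_boundary_dart (A ∪ B) ha hb
    have hlt : ∀ A' B' : Set V, A' ∪ B' = insert d.snd (A ∪ B) → (A' ∪ B')ᶜ.ncard < m := by
      intro A' B' e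
      rw [← hm, e]
      apply Set.ncard_lt_ncard _ (Set.toFinite _)
      exact compl_lt_compl_iff_lt.2 (Set.ssubset_insert h2)
    have h2' : d.snd ∉ A ∧ d.snd ∉ B := by simpa using h2
    rcases h1 with h1 | h1
    · refine ih _ (hlt (insert d.snd A) B (by rw [Set.insert_union])) _ _ ⟨?_, hA.trans (Set.subset_insert _ _), hB, cA.insert_of_adj h1 d.adj, cB⟩ rfl
      exact Set.disjoint_insert_left.2 ⟨h2'.2, hd⟩
    · refine ih _ (hlt A (insert d.snd B) (by rw [Set.union_insert])) _ _ ⟨?_, hA, hB.trans (Set.subset_insert _ _), cA, cB.insert_of_adj h1 d.adj⟩ rfl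
      exact Set.disjoint_insert_right.2 ⟨h2'.1, hd⟩

end SimpleGraph

/-! ### The machine model

Random access programs under the logarithmic cost criterion. The memory consists of finitely many
arrays of natural numbers (a scalar variable is an array that is only used at index `0`). A program
is a fixed finite text, independent of the input. Every operation is charged the bit length of the
numbers and addresses it handles. The space of a memory content is the total bit length of its
nonzero cells together with their addresses, so that a memory content of space `s` can be written
down with `O(s)` bits and each elementary operation can be simulated on a multitape Turing machine
in time polynomial in `s` and its cost. -/

namespace RAM

/-- Memory: the pair `(k, i)` addresses cell `i` of array `k`; all but finitely many cells
hold `0`. -/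
abbrev Store : Type := ℕ × ℕ →₀ ℕ

/-- The built-in binary operations. -/
inductive Op : Type
  | add | sub | mul | div | mod | eq | lt

/-- Subtraction is truncated at `0`, division rounds down, and truth values are `0` and `1`. -/
def Op.eval : Op → ℕ → ℕ → ℕ
  | .add, a, b => a + b
  | .sub, a, b => a - b
  | .mul, a, b => a * b
  | .div, a, b => a / b
  | .mod, a, b => a % b
  | .eq, a, b => if a = b then 1 else 0
  | .lt, a, b => if a < b then 1 else 0

/-- Expressions: constants, `k[e]` (array `k` at the index that `e` evaluates to), and
applications of a built-in operation. -/
inductive Expr : Type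
  | lit (c : ℕ)
  | get (k : ℕ) (e : Expr)
  | op (o : Op) (e₁ e₂ : Expr)

/-- The value of an expression. -/
def Expr.eval (σ : Store) : Expr → ℕ
  | .lit c => c
  | .get k e => σ (k, e.eval σ)
  | .op o e₁ e₂ => o.eval (e₁.eval σ) (e₂.eval σ)

/-- The logarithmic cost of evaluating an expression: every constant, memory access and operation
costs one plus the bit lengths of the constant, of the address and content, and of the operands,
respectively (`Nat.size` is the bit length). -/
def Expr.cost (σ : Store) : Expr → ℕ
  | .lit c => 1 + c.size
  | .get k e => e.cost σ + (1 + (e.eval σ).size + (σ (k, e.eval σ)).size)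
  | .op _ e₁ e₂ => e₁.cost σ + e₂.cost σ + (1 + (e₁.eval σ).size + (e₂.eval σ).size)

/-- Programs: do nothing, the assignment `k[a] := e`, sequential composition, branching and
loops. A condition holds if its value is not `0`. -/
inductive Program : Type
  | skip
  | assign (k : ℕ) (a e : Expr)
  | seq (P Q : Program)
  | ite (b : Expr) (P Q : Program)
  | loop (b : Expr) (P : Program)

/-- The space of a memory content: the total bit length of the nonzero cells and of
their addresses. -/
def space (σ : Store) : ℕ :=
  σ.sum fun c v => c.1.size + c.2.size + v.size

/-- `Runs P σ σ' t s`: started in memory `σ`, the program `P` halts in memory `σ'`, after a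
computation of total logarithmic cost `t` in which the largest space of a memory content is `s`. -/
inductive Runs : Program → Store → Store → ℕ → ℕ → Prop
  | skip (σ : Store) : Runs .skip σ σ 1 (space σ)
  | assign (k : ℕ) (a e : Expr) (σ : Store) :
      Runs (.assign k a e) σ (σ.update (k, a.eval σ) (e.eval σ))
        (a.cost σ + e.cost σ + (1 + (a.eval σ).size + (e.eval σ).size))
        (max (space σ) (space (σ.update (k, a.eval σ) (e.eval σ))))
  | seq {P Q : Program} {σ σ' σ'' : Store} {t t' s s' : ℕ} :
      Runs P σ σ' t s → Runs Q σ' σ'' t' s' → Runs (.seq P Q) σ σ'' (t + t') (max s s')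
  | ite_true {b : Expr} {P Q : Program} {σ σ' : Store} {t s : ℕ} :
      b.eval σ ≠ 0 → Runs P σ σ' t s → Runs (.ite b P Q) σ σ' (b.cost σ + 1 + t) s
  | ite_false {b : Expr} {P Q : Program} {σ σ' : Store} {t s : ℕ} :
      b.eval σ = 0 → Runs Q σ σ' t s → Runs (.ite b P Q) σ σ' (b.cost σ + 1 + t) s
  | loop_done {b : Expr} {P : Program} {σ : Store} :
      b.eval σ = 0 → Runs (.loop b P) σ σ (b.cost σ + 1) (space σ)
  | loop_step {b : Expr} {P : Program} {σ σ' σ'' : Store} {t t' s s' : ℕ} :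
      b.eval σ ≠ 0 → Runs P σ σ' t s → Runs (.loop b P) σ' σ'' t' s' →
      Runs (.loop b P) σ σ'' (b.cost σ + 1 + t + t') (max s s')

/-- Programs are deterministic: the final memory, the time and the space are determined by the
program and the initial memory. -/
theorem Runs.det {P : Program} {σ σ₁ σ₂ : Store} {t₁ t₂ s₁ s₂ : ℕ} (h₁ : Runs P σ σ₁ t₁ s₁)
    (h₂ : Runs P σ σ₂ t₂ s₂) : σ₁ = σ₂ ∧ t₁ = t₂ ∧ s₁ = s₂ := by
  induction h₁ generalizing σ₂ t₂ s₂ with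
  | skip => cases h₂; simp
  | assign => cases h₂; simp
  | seq _ _ ih ih' =>
    cases h₂ with
    | seq a b => obtain ⟨rfl, rfl, rfl⟩ := ih a; obtain ⟨rfl, rfl, rfl⟩ := ih' b; simp
  | ite_true h _ ih => cases h₂ with
    | ite_true _ a => obtain ⟨rfl, rfl, rfl⟩ := ih a; simp
    | ite_false h' => exact absurd h' h
  | ite_false h _ ih => cases h₂ with
    | ite_false _ a => obtain ⟨rfl, rfl, rfl⟩ := ih a; simp
    | ite_true h' => exact absurd h h'
  | loop_done h => cases h₂ with
    | loop_done => simp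
    | loop_step h' => exact absurd h h'
  | loop_step h _ _ ih ih' => cases h₂ with
    | loop_done h' => exact absurd h' h
    | loop_step _ a b => obtain ⟨rfl, rfl, rfl⟩ := ih a; obtain ⟨rfl, rfl, rfl⟩ := ih' b; simp

open scoped Classical in
/-- The initial memory for a graph on the vertices `0, …, n - 1` with two vertex sets: `0[0]` holds
`n`, array `1` holds the adjacency matrix of the graph row by row, arrays `2` and `3` hold the
indicator vectors of the two sets, and all other cells hold `0`. -/
noncomputable def input {n : ℕ} (G : SimpleGraph (Fin n)) (Z₁ Z₂ : Set (Fin n)) : Store :=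
  Finsupp.onFinset (Finset.range 4 ×ˢ Finset.range (n * n + n + 1))
    (fun c =>
      if c = (0, 0) then n
      else if c.1 = 1 ∧ ∃ u v : Fin n, c.2 = u * n + v ∧ G.Adj u v then 1
      else if c.1 = 2 ∧ ∃ u ∈ Z₁, c.2 = (u : ℕ) then 1
      else if c.1 = 3 ∧ ∃ u ∈ Z₂, c.2 = (u : ℕ) then 1
      else 0)
    (by
      rintro ⟨k, i⟩ h
      simp only [Finset.mem_product, Finset.mem_range]
      split_ifs at h with h₀ h₁ h₂ h₃
      · obtain ⟨rfl, rfl⟩ := Prod.mk.inj h₀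
        constructor <;> omega
      · obtain ⟨hk, u, v, hi, -⟩ := h₁
        have hu : (u : ℕ) * n + v < n * n := by
          have := Nat.mul_le_mul_right n (Nat.succ_le_of_lt u.isLt)
          rw [Nat.succ_mul] at this
          have := v.isLt
          omega
        simp only at hk hi
        constructor <;> omega
      · obtain ⟨hk, u, -, hi⟩ := h₂
        have := u.isLt
        simp only at hk hi
        constructor <;> omega
      · obtain ⟨hk, u, -, hi⟩ := h₃
        have := u.isLt
        simp only at hk hi
        constructor <;> omega
      · exact absurd rfl h)

/-- The answer of a halted program is read off from cell `4[0]`. -/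
def output (σ : Store) : ℕ := σ (4, 0)

end RAM

/-!
Let `X` be the smaller and `Y` the larger of the two terminal sets, `k = |X|`, and let `u` be the
number of the remaining, free vertices, so that `u + 2 * k ≤ n`. Because `G` is connected, the
answer is yes if and only if some vertex set `A` has the property that `X` lies in one component of
`G[A]` and `Y` in one component of `G[Aᶜ]` (`twoDisjointConnected_iff_exists_joined`), and this is
easy to check for a given `A`. Two lists of candidates for `A` are tried in parallel.

* The first list consists of the `2 ^ u` sets that contain `X` and avoid `Y`.
* The second list contains all minimal connected sets `S` that include `X` and avoid `Y`, and has
  `9 ^ k * (3 / 2) ^ u` entries. Such a set is grown from `K = X`. For one terminal `r` after the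
  other, consider the component `C` of `r` in `G[K]`. Either exactly one vertex of `S \ K` is
  adjacent to `C` (`C` is a leaf); then it is one of the `d` undecided neighbours of `C`, it is
  added to `K`, and the other `d - 1` are discarded. Or `C` is not a leaf; then the search goes on
  to the next terminal. By minimality every vertex of `S \ K` separates `G[S]`, so that some
  component of `G[K]` is a leaf as long as `K ≠ S` (`exists_leaf`). It follows that `K = S` after
  the last terminal. The choices are encoded in a number from an interval of length `9 ^ k * 3 ^ u`:
  going on takes the first ninth of the current interval, and each of the `d` neighbours takes the
  fraction `(2 / 3) ^ d`, which is possible because `1 / 9 + d * (2 / 3) ^ d ≤ 1`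
  (`nine_mul_two_pow_le`). Since `k` steps go on and at most `u` vertices are decided, an interval
  of length `2 ^ u` is left in the end, and so it suffices to decode the multiples of `2 ^ u`
  (`exists_joined_grown`).

The loop stops at the first `j` with `2 ^ u ≤ j` or `9 ^ k * 3 ^ u ≤ j * 2 ^ u`, where one of the
lists is exhausted. Before that, `j ^ 2 ≤ 9 ^ k * 3 ^ u ≤ 3 ^ n` (`sq_le_of_open`), so that there
are `O(3 ^ (n / 2))` rounds, and `3 < 1.7804 ^ 2`. Only one candidate is stored at a time.

For the cost of the program it suffices that, within a round, every loop is repeated at most `B`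
times and all numbers and addresses stay below `2 ^ B` and `B`, for a `B` that is polynomial in `n`:
then time and space are bounded by polynomials in `B` that can be read off from the program text
(`Exec.runs`). Correctness of the program is derived by weakest preconditions (`Wp`).
-/

namespace SimpleGraph

/-! ### Reachability inside a vertex set -/

section Reach

variable {V : Type*} (G : SimpleGraph V)

/-- `G.Reach A x y`: there is a walk from `x` to `y` all of whose vertices, except possibly `x`
itself, lie in `A`. -/
def Reach (A : Finset V) : V → V → Prop :=
  Relation.ReflTransGen fun p q => G.Adj p q ∧ q ∈ A

/-- The vertices of `X` lie in a single component of `G[A]` (for empty `X` this always holds). -/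
def Joined (A X : Finset V) : Prop :=
  X ⊆ A ∧ ∀ x ∈ X, ∀ y ∈ X, G.Reach A x y

variable {G} {A A' X S K : Finset V} {x y z : V}

theorem Reach.mono (h : A ⊆ A') (hxy : G.Reach A x y) : G.Reach A' x y := by
  induction hxy with
  | refl => exact .refl
  | tail _ h' ih => exact Relation.ReflTransGen.tail ih ⟨h'.1, h h'.2⟩

theorem Reach.trans (hxy : G.Reach A x y) (hyz : G.Reach A y z) : G.Reach A x z :=
  Relation.ReflTransGen.trans hxy hyz

theorem Reach.tail (hxy : G.Reach A x y) (h : G.Adj y z) (hz : z ∈ A) : G.Reach A x z :=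
  Relation.ReflTransGen.tail hxy ⟨h, hz⟩

theorem Reach.mem (hx : x ∈ A) (hxy : G.Reach A x y) : y ∈ A := by
  cases hxy with
  | refl => exact hx
  | tail _ h => exact h.2

theorem Reach.symm (hx : x ∈ A) (hxy : G.Reach A x y) : G.Reach A y x := by
  induction hxy with
  | refl => exact .refl
  | tail hab h ih => exact Relation.ReflTransGen.head ⟨h.1.symm, Reach.mem hx hab⟩ ih

/-- A set that is closed under stepping to neighbours in `A` contains everything reachable from
its members. -/
theorem Reach.of_closed {C : V → Prop} (hC : ∀ p q, C p → G.Adj p q → q ∈ A → C q)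
    (hxy : G.Reach A x y) (hx : C x) : C y := by
  induction hxy with
  | refl => exact hx
  | tail _ h ih => exact hC _ _ ih h.1 h.2

theorem connectedOn_coe_iff : G.ConnectedOn (A : Set V) ↔ G.Joined A A := by
  constructor
  · intro h
    refine ⟨subset_rfl, fun x hx y hy => ?_⟩
    have := (SimpleGraph.reachable_iff_reflTransGen _ _).1 (h ⟨x, hx⟩ ⟨y, hy⟩)
    have key : ∀ z, Relation.ReflTransGen (G.induce (A : Set V)).Adj ⟨x, hx⟩ z →
        G.Reach A x z := by
      intro z hz
      induction hz with
      | refl => exact .refl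
      | @tail b c _ h' ih => exact ih.tail (by simpa using h') c.2
    exact key _ this
  · rintro ⟨-, h⟩ ⟨x, hx⟩ ⟨y, hy⟩
    have key : ∀ z, G.Reach A x z → ∀ hz : z ∈ (A : Set V),
        (G.induce (A : Set V)).Reachable ⟨x, hx⟩ ⟨z, hz⟩ := by
      intro z hz
      induction hz with
      | refl => intro _; exact .refl _
      | tail hab h' ih =>
        intro hz
        exact (ih (Reach.mem hx hab)).trans (SimpleGraph.Adj.reachable (by simpa using h'.1))
    exact key y (h x hx y hy) hy

theorem Joined.mono (h : A ⊆ A') (hA : G.Joined A X) : G.Joined A' X :=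
  ⟨hA.1.trans h, fun x hx y hy => (hA.2 x hx y hy).mono h⟩

theorem Joined.subset {X' : Finset V} (h : X' ⊆ X) (hA : G.Joined A X) : G.Joined A X' :=
  ⟨h.trans hA.1, fun x hx y hy => hA.2 x (h hx) y (h hy)⟩

open scoped Classical in
/-- Terminals joined in `A` lie in a connected subset of `A`. -/
theorem Joined.exists_connectedOn [Fintype V] (h : G.Joined A X) :
    ∃ C ⊆ A, X ⊆ C ∧ G.Joined C C := by
  rcases X.eq_empty_or_nonempty with rfl | ⟨x, hx⟩
  · exact ⟨∅, by simp, by simp, by simp [Joined]⟩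
  · let C := A.filter (G.Reach A x)
    have hxA := h.1 hx
    have hC : ∀ y, G.Reach A x y → G.Reach C x y := by
      intro y hy
      induction hy with
      | refl => exact .refl
      | tail hab h' ih =>
        exact ih.tail h'.1 (Finset.mem_filter.2 ⟨h'.2, Reach.tail hab h'.1 h'.2⟩)
    have hxC : x ∈ C := Finset.mem_filter.2 ⟨hxA, .refl⟩
    refine ⟨C, Finset.filter_subset _ _, fun y hy => Finset.mem_filter.2
      ⟨h.1 hy, h.2 x hx y hy⟩, subset_rfl, fun y hy z hz => ?_⟩
    exact ((hC y (Finset.mem_filter.1 hy).2).symm hxC).trans (hC z (Finset.mem_filter.1 hz).2)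

/-- The decision problem in terms of a single vertex set: since `G` is connected, vertices outside
the two components can be distributed afterwards. -/
theorem twoDisjointConnected_iff_exists_joined [Fintype V] [DecidableEq V] (hG : G.Preconnected)
    (X Y : Finset V) :
    G.TwoDisjointConnected (X : Set V) (Y : Set V) ↔
      ∃ A : Finset V, G.Joined A X ∧ G.Joined Aᶜ Y := by
  classical
  rw [twoDisjointConnected_iff G hG]
  constructor
  · rintro ⟨A, B, hd, hX, hY, hA, hB⟩
    lift A to Finset V using Set.toFinite A
    lift B to Finset V using Set.toFinite B
    rw [connectedOn_coe_iff] at hA hB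
    rw [Finset.coe_subset] at hX hY
    rw [Finset.disjoint_coe] at hd
    refine ⟨A, hA.subset hX, (hB.subset hY).mono fun v hv => ?_⟩
    exact Finset.mem_compl.2 fun h => Finset.disjoint_left.1 hd h hv
  · rintro ⟨A, hX, hY⟩
    obtain ⟨C, hCA, hXC, hC⟩ := hX.exists_connectedOn
    obtain ⟨C', hCA', hYC, hC'⟩ := hY.exists_connectedOn
    refine ⟨C, C', ?_, by exact_mod_cast hXC, by exact_mod_cast hYC,
      connectedOn_coe_iff.2 hC, connectedOn_coe_iff.2 hC'⟩
    rw [Finset.disjoint_coe]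
    exact Finset.disjoint_left.2 fun v h h' => Finset.mem_compl.1 (hCA' h') (hCA h)

/-! ### Leaf components -/

/-- The component of `a` in `G[K]` has exactly one neighbour in `S` outside `K`. -/
def Leaf (G : SimpleGraph V) (S K : Finset V) (a : V) : Prop :=
  ∃! w, w ∈ S ∧ w ∉ K ∧ ∃ x, G.Reach K a x ∧ G.Adj x w

/-- Let `S` be a minimal connected superset of a terminal set. If `K` contains the terminals and is
a proper subset of `S`, some component of `G[K]` has exactly one neighbour in `S` outside `K`:
every vertex `v` of `S \ K` separates `G[S]`, and when `v` is chosen such that the part cut off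
from a fixed terminal is as small as possible, this part lies in `K`. -/
theorem exists_leaf [DecidableEq V] {t : V} (ht : t ∈ K) (hKS : K ⊆ S) (hne : K ≠ S)
    (hS : G.Joined S S) (hmin : ∀ v ∈ S, v ∉ K → ¬ G.Joined (S.erase v) (S.erase v)) :
    ∃ a ∈ K, G.Leaf S K a := by
  classical
  let cut : V → Finset V := fun v => (S.erase v).filter fun y => ¬ G.Reach (S.erase v) t y
  have hnonempty : (S \ K).Nonempty := by
    rw [Finset.sdiff_nonempty]
    exact fun h => hne (hKS.antisymm h)
  obtain ⟨v, hv, hvmin⟩ := Finset.exists_min_image (S \ K) (fun v => (cut v).card) hnonempty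
  obtain ⟨hvS, hvK⟩ := Finset.mem_sdiff.1 hv
  have htv : t ∈ S.erase v := Finset.mem_erase.2 ⟨fun h => hvK (h ▸ ht), hKS ht⟩
  have hcut : (cut v).Nonempty := by
    by_contra h
    rw [Finset.not_nonempty_iff_eq_empty, Finset.filter_eq_empty_iff] at h
    refine hmin v hvS hvK ⟨subset_rfl, fun x hx y hy => ?_⟩
    exact (Reach.symm htv (not_not.1 (h hx))).trans (not_not.1 (h hy))
  -- `v` is adjacent to the part that contains `t`
  obtain ⟨c, hc⟩ := hcut
  obtain ⟨hcS, hcr⟩ := Finset.mem_filter.1 hc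
  obtain ⟨p, hp, hpv⟩ : ∃ p, G.Reach (S.erase v) t p ∧ G.Adj p v := by
    by_contra! h
    refine hcr (Reach.of_closed (A := S) (C := G.Reach (S.erase v) t) (fun p q hp hpq hq => ?_)
      (hS.2 t (hKS ht) c (Finset.mem_of_mem_erase hcS)) .refl)
    exact hp.tail hpq (Finset.mem_erase.2 ⟨fun e => h p hp (e ▸ hpq), hq⟩)
  have hcutK : cut v ⊆ K := by
    intro v' hv'
    by_contra hK
    obtain ⟨hv'S, hv'r⟩ := Finset.mem_filter.1 hv'
    have hv'S' := Finset.mem_of_mem_erase hv'S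
    refine absurd (hvmin v' (Finset.mem_sdiff.2 ⟨hv'S', hK⟩)) (not_le.2 ?_)
    have hreach : ∀ y, G.Reach (S.erase v) t y → G.Reach (S.erase v') t y := by
      intro y hy
      induction hy with
      | refl => exact .refl
      | tail hab h ih =>
        refine ih.tail h.1 (Finset.mem_erase.2 ⟨?_, Finset.mem_of_mem_erase h.2⟩)
        rintro rfl
        exact hv'r (Reach.tail hab h.1 h.2)
    refine Finset.card_lt_card (Finset.ssubset_iff_of_subset (fun y hy => ?_) |>.2
      ⟨v', hv', by simp [cut]⟩)
    obtain ⟨hyS, hyr⟩ := Finset.mem_filter.1 hy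
    refine Finset.mem_filter.2 ⟨Finset.mem_erase.2 ⟨?_, Finset.mem_of_mem_erase hyS⟩,
      fun h => hyr (hreach y h)⟩
    rintro rfl
    exact hyr ((hreach p hp).tail hpv (Finset.mem_erase.2
      ⟨(Finset.ne_of_mem_erase hv'S).symm, hvS⟩))
  -- so the component of `c` in `G[K]` is contained in `cut v` and can only be left through `v`
  have hcK := hcutK hc
  have hclosed : ∀ p q, p ∈ cut v → G.Adj p q → q ∈ S → q ≠ v → q ∈ cut v := by
    intro p q hp hpq hq hqv
    have hqe : q ∈ S.erase v := Finset.mem_erase.2 ⟨hqv, hq⟩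
    obtain ⟨hpS, hpr⟩ := Finset.mem_filter.1 hp
    exact Finset.mem_filter.2 ⟨hqe, fun h => hpr (h.tail hpq.symm hpS)⟩
  have hcomp : ∀ x, G.Reach K c x → x ∈ cut v := fun x hx =>
    Reach.of_closed (C := (· ∈ cut v)) (fun p q hp hpq hq => hclosed p q hp hpq (hKS hq)
      (fun e => hvK (e ▸ hq))) hx hc
  have honly : ∀ w, w ∈ S → w ∉ K → (∃ x, G.Reach K c x ∧ G.Adj x w) → w = v := by
    rintro w hw hwK ⟨x, hx, hxw⟩
    by_contra hne
    exact hwK (hcutK (hclosed x w (hcomp x hx) hxw hw hne))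
  refine ⟨c, hcK, v, ⟨hvS, hvK, ?_⟩, fun w hw => honly w hw.1 hw.2.1 hw.2.2⟩
  by_contra! h
  refine hvK (Reach.mem hcK (Reach.of_closed (A := S) (C := G.Reach K c)
    (fun p q hp hpq hq => ?_) (hS.2 c (hKS hcK) v hvS) .refl))
  by_cases hqK : q ∈ K
  · exact hp.tail hpq hqK
  · exact absurd (honly q hq hqK ⟨p, hp, hpq⟩ ▸ hpq) (h p hp)

end Reach
/-! ### Decoding numbers into vertex sets -/

section Decode

variable {n : ℕ}

/-- The number of elements of `N` that precede `v`. -/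
def rank (N : Finset (Fin n)) (v : ℕ) : ℕ :=
  (N.filter fun w => w.val < v).card

variable {N : Finset (Fin n)}

theorem rank_zero : rank N 0 = 0 := by simp [rank]

theorem rank_self : rank N n = N.card := by
  simp [rank]

theorem rank_succ_of_mem {v : Fin n} (hv : v ∈ N) : rank N (v + 1) = rank N v + 1 := by
  have : (N.filter fun w : Fin n => w.val < v + 1) =
      insert v (N.filter fun w : Fin n => w.val < v.val) := by
    ext w
    simp only [Finset.mem_filter, Finset.mem_insert, Nat.lt_succ_iff_lt_or_eq, Fin.val_inj]
    constructor
    · rintro ⟨h, h' | rfl⟩ <;> tauto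
    · rintro (rfl | h) <;> tauto
  rw [rank, this, Finset.card_insert_of_notMem (by simp), rank]

theorem rank_succ_of_notMem {v : Fin n} (hv : v ∉ N) : rank N (v + 1) = rank N v := by
  unfold rank
  congr 1
  ext w
  simp only [Finset.mem_filter, Nat.lt_succ_iff_lt_or_eq, Fin.val_inj]
  constructor
  · rintro ⟨h, h' | rfl⟩ <;> tauto
  · tauto

theorem rank_mono {v w : ℕ} (h : v ≤ w) : rank N v ≤ rank N w :=
  Finset.card_le_card (Finset.monotone_filter_right _ fun _ _ hx => hx.trans_le h)

theorem rank_lt_rank {v : Fin n} {w : ℕ} (hv : v ∈ N) (h : v.val < w) : rank N v < rank N w := by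
  have := rank_succ_of_mem hv
  have := rank_mono (N := N) (show v.val + 1 ≤ w from h)
  omega

theorem rank_lt_card {v : Fin n} (hv : v ∈ N) : rank N v < N.card := by
  simpa [rank_self] using rank_lt_rank hv v.isLt

theorem rank_injOn {v w : Fin n} (hv : v ∈ N) (hw : w ∈ N) (h : rank N v = rank N w) : v = w := by
  rcases lt_trichotomy v.val w.val with h' | h' | h'
  · exact absurd h (rank_lt_rank hv h').ne
  · exact Fin.ext h'
  · exact absurd h (rank_lt_rank hw h').ne'

/-- The vertices outside both terminal sets. -/
def free (X Y : Finset (Fin n)) : Finset (Fin n) := (X ∪ Y)ᶜ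

/-- The set that consists of `X` and those free vertices whose bit in `j` is set. -/
def bitSet (X Y : Finset (Fin n)) (j : ℕ) : Finset (Fin n) :=
  X ∪ (free X Y).filter fun v => j.testBit (rank (free X Y) v)

theorem exists_bitSet_eq {X Y S : Finset (Fin n)} (hX : X ⊆ S) (hY : Disjoint S Y) :
    ∃ j < 2 ^ (free X Y).card, bitSet X Y j = S := by
  classical
  refine ⟨Nat.ofBits fun i : Fin (free X Y).card =>
    decide (∃ v ∈ free X Y, v ∈ S ∧ rank (free X Y) v = i), Nat.ofBits_lt_two_pow _, ?_⟩
  ext v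
  rw [bitSet, Finset.mem_union, Finset.mem_filter]
  constructor
  · rintro (h | ⟨hf, h⟩)
    · exact hX h
    · rw [Nat.testBit_ofBits_lt _ _ (rank_lt_card hf), decide_eq_true_iff] at h
      obtain ⟨w, hw, hwS, e⟩ := h
      exact rank_injOn hw hf e ▸ hwS
  · intro hv
    by_cases hvX : v ∈ X
    · exact .inl hvX
    · have hf : v ∈ free X Y := by
        simp [free, hvX, Finset.disjoint_left.1 hY hv]
      refine .inr ⟨hf, ?_⟩
      rw [Nat.testBit_ofBits_lt _ _ (rank_lt_card hf), decide_eq_true_iff]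
      exact ⟨v, hf, hv, rfl⟩

/-- `d` times one third off, rounded down. -/
def shrink (F d : ℕ) : ℕ := (fun g => g / 3 * 2)^[d] F

theorem shrink_le (F d : ℕ) : shrink F d ≤ F := by
  induction d with
  | zero => exact le_rfl
  | succ d ih =>
    rw [shrink, Function.iterate_succ_apply']
    change shrink F d / 3 * 2 ≤ F
    omega

theorem shrink_succ (F d : ℕ) : shrink F (d + 1) = shrink F d / 3 * 2 := by
  rw [shrink, Function.iterate_succ_apply', shrink]

theorem shrink_eq (a b d : ℕ) : shrink (a * 3 ^ (b + d)) d = a * 3 ^ b * 2 ^ d := by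
  induction d generalizing b with
  | zero => simp [shrink]
  | succ d ih =>
    rw [shrink_succ, show b + (d + 1) = (b + 1) + d by ring, ih,
      show a * 3 ^ (b + 1) * 2 ^ d = a * 3 ^ b * 2 ^ d * 3 by ring,
      Nat.mul_div_cancel _ (by norm_num)]
    ring

/-- One ninth and `d` times the fraction `(2/3) ^ d` add up to at most one; equality holds for
`d = 2` and for `d = 3`. -/
theorem nine_mul_two_pow_le (d : ℕ) : 9 * (d * 2 ^ d) ≤ 8 * 3 ^ d := by
  rcases lt_or_ge d 3 with h | h
  · interval_cases d <;> norm_num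
  · induction d, h using Nat.le_induction with
    | base => norm_num
    | succ d hd ih =>
      have h1 : (d + 1) * 2 ≤ d * 3 := by omega
      calc 9 * ((d + 1) * 2 ^ (d + 1)) = 9 * 2 ^ d * ((d + 1) * 2) := by ring
        _ ≤ 9 * 2 ^ d * (d * 3) := Nat.mul_le_mul_left _ h1
        _ = 9 * (d * 2 ^ d) * 3 := by ring
        _ ≤ 8 * 3 ^ d * 3 := Nat.mul_le_mul_right _ ih
        _ = 8 * 3 ^ (d + 1) := by ring

end Decode

/-! ### Growing a minimal connecting set -/

section Grow

variable {n : ℕ} (G : SimpleGraph (Fin n))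

/-- The state of the search for a connecting set: `K` is the set built so far, `D` the set of
vertices on which a decision has been taken, `r` the current terminal, `I` the number that remains
to be decoded, and `F` the length of the interval from which it is taken. -/
@[ext] structure State (n : ℕ) where
  K : Finset (Fin n)
  D : Finset (Fin n)
  r : ℕ
  I : ℕ
  F : ℕ

open scoped Classical in
/-- The component of `r` in `G[A]`; empty if `r` is not a member of `A`. -/
noncomputable def comp (A : Finset (Fin n)) (r : ℕ) : Finset (Fin n) :=
  Finset.univ.filter fun y => ∃ x ∈ A, x.val = r ∧ G.Reach A x y

open scoped Classical in
/-- The neighbours of `C` outside `D`. -/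
noncomputable def nbrs (C D : Finset (Fin n)) : Finset (Fin n) :=
  Finset.univ.filter fun y => y ∉ D ∧ ∃ x ∈ C, G.Adj x y

/-- The initial state: the interval is long enough for a factor `9` for each terminal and a factor
`3` for each free vertex. -/
def start (X Y : Finset (Fin n)) (I : ℕ) : State n :=
  ⟨X, X ∪ Y, 0, I, 9 ^ X.card * 3 ^ (free X Y).card⟩

open scoped Classical in
/-- One step of the search. Let `C` be the component of the current terminal `r` in `G[K]` and `N`
the set of its undecided neighbours. The number `I` selects between going on to the next terminal
and adding exactly one vertex of `N` to `K`. The first alternative takes one ninth of the interval,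
each of the others the fraction `(2/3) ^ #N`; numbers in the rest of the interval discard `N`
without adding a vertex. -/
noncomputable def grow (X : Finset (Fin n)) (s : State n) : State n :=
  if s.r < n then
    if ∃ v ∈ X, v.val = s.r then
      if s.I < s.F / 9 then { s with F := s.F / 9, r := s.r + 1 }
      else
        let N := G.nbrs (G.comp s.K s.r) s.D
        let F' := shrink s.F N.card
        { K := s.K ∪ N.filter fun v => rank N v = (s.I - s.F / 9) / F'
          D := s.D ∪ N
          r := s.r
          I := (s.I - s.F / 9) % F'
          F := F' }
    else { s with r := s.r + 1 }
  else s

/-- The set found by the search that starts with the number `I`. -/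
noncomputable def grown (X Y : Finset (Fin n)) (I : ℕ) : Finset (Fin n) :=
  ((G.grow X)^[2 * n] (start X Y I)).K

/-- The state `s` is on the way to the set `S`: the vertices of `S` on which a decision has been
taken are those of `K`, every vertex of `K` is attached to a terminal, and a terminal before `r` is
attached to a terminal that is still to come or has a component that is not a leaf. -/
structure OnTrack (X S : Finset (Fin n)) (s : State n) : Prop where
  subset : X ⊆ s.K
  inter : ∀ v, v ∈ s.K ↔ v ∈ s.D ∧ v ∈ S
  attached : ∀ v ∈ s.K, ∃ t ∈ X, G.Reach s.K v t
  passed : ∀ t ∈ X, t.val < s.r →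
    (∃ t' ∈ X, s.r ≤ t'.val ∧ G.Reach s.K t t') ∨ ¬ G.Leaf S s.K t

variable {G}

theorem Leaf.congr {V : Type*} {G : SimpleGraph V} {S K : Finset V} {a b : V} (ha : a ∈ K)
    (hab : G.Reach K a b) : G.Leaf S K a ↔ G.Leaf S K b := by
  have h : ∀ x, G.Reach K a x ↔ G.Reach K b x :=
    fun x => ⟨fun h => (hab.symm ha).trans h, fun h => hab.trans h⟩
  simp only [Leaf, h]

theorem mem_comp {A : Finset (Fin n)} {r : Fin n} (hr : r ∈ A) {y : Fin n} :
    y ∈ G.comp A r ↔ G.Reach A r y := by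
  simp only [comp, Finset.mem_filter, Finset.mem_univ, true_and]
  constructor
  · rintro ⟨x, -, hx, h⟩
    rwa [Fin.ext hx] at h
  · exact fun h => ⟨r, hr, rfl, h⟩

theorem mem_nbrs {C D : Finset (Fin n)} {y : Fin n} :
    y ∈ G.nbrs C D ↔ y ∉ D ∧ ∃ x ∈ C, G.Adj x y := by
  simp [nbrs]

theorem OnTrack.eq_of_le {X S : Finset (Fin n)} {s : State n} (h : G.OnTrack X S s)
    (hS : G.Joined S S) (hmin : ∀ v ∈ S, v ∉ X → ¬ G.Joined (S.erase v) (S.erase v))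
    (hX : X.Nonempty) (hr : n ≤ s.r) : s.K = S := by
  by_contra hne
  obtain ⟨t, ht⟩ := hX
  obtain ⟨a, ha, hleaf⟩ := exists_leaf (h.subset ht) (fun v hv => ((h.inter v).1 hv).2) hne hS
    fun v hv hvK => hmin v hv fun hvX => hvK (h.subset hvX)
  obtain ⟨b, hb, hab⟩ := h.attached a ha
  rcases h.passed b hb (b.isLt.trans_le hr) with ⟨t', -, h', -⟩ | h'
  · exact absurd (t'.isLt.trans_le hr) (not_lt.2 h')
  · exact h' ((Leaf.congr ha hab).1 hleaf)

/-- Going on from a vertex that is not a terminal. -/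
theorem OnTrack.skip {X S : Finset (Fin n)} {s : State n} (h : G.OnTrack X S s)
    (hr : ¬ ∃ v ∈ X, v.val = s.r) (I F : ℕ) :
    G.OnTrack X S { s with r := s.r + 1, I := I, F := F } := by
  refine ⟨h.subset, h.inter, h.attached, fun t ht htr => ?_⟩
  have hne : ∀ t' ∈ X, t'.val ≠ s.r := fun t' ht' e => hr ⟨t', ht', e⟩
  rcases h.passed t ht (lt_of_le_of_ne (Nat.lt_succ_iff.1 htr) (hne t ht)) with
    ⟨t', ht', h1, h2⟩ | h'
  · exact .inl ⟨t', ht', lt_of_le_of_ne h1 (hne t' ht').symm, h2⟩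
  · exact .inr h'

/-- Going on from a terminal whose component is not a leaf. -/
theorem OnTrack.mark {X S : Finset (Fin n)} {s : State n} (h : G.OnTrack X S s) {v : Fin n}
    (hvX : v ∈ X) (hv : v.val = s.r) (hleaf : ¬ G.Leaf S s.K v) (I F : ℕ) :
    G.OnTrack X S { s with r := s.r + 1, I := I, F := F } := by
  refine ⟨h.subset, h.inter, h.attached, fun t ht htr => ?_⟩
  have hK := h.subset ht
  rcases (Nat.lt_succ_iff.1 htr).lt_or_eq with htr | htr
  · rcases h.passed t ht htr with ⟨t', ht', h1, h2⟩ | h'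
    · rcases h1.lt_or_eq with h1 | h1
      · exact .inl ⟨t', ht', h1, h2⟩
      · obtain rfl : t' = v := Fin.ext (h1.symm.trans hv.symm)
        exact .inr fun hl => hleaf ((Leaf.congr hK h2).1 hl)
    · exact .inr h'
  · obtain rfl : t = v := Fin.ext (htr.trans hv.symm)
    exact .inr hleaf

/-- Adding the only neighbour of a leaf. -/
theorem OnTrack.extend {X S : Finset (Fin n)} {s : State n} (h : G.OnTrack X S s) {v w : Fin n}
    (hvX : v ∈ X) (hv : v.val = s.r) (hwS : w ∈ S) (hwK : w ∉ s.K)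
    (hw : ∃ x, G.Reach s.K v x ∧ G.Adj x w) {N : Finset (Fin n)} (hN : ∀ u ∈ N, u ∈ S ↔ u = w)
    (hwN : w ∈ N) (I F : ℕ) :
    G.OnTrack X S ⟨s.K ∪ {w}, s.D ∪ N, s.r, I, F⟩ := by
  have hmono : s.K ⊆ s.K ∪ {w} := Finset.subset_union_left
  have hwK' : w ∈ s.K ∪ {w} := by simp
  have hvK := h.subset hvX
  obtain ⟨x, hvx, hxw⟩ := hw
  have hvw : G.Reach (s.K ∪ {w}) v w := (hvx.mono hmono).tail hxw hwK'
  refine ⟨h.subset.trans hmono, fun u => ?_, fun u hu => ?_, fun t ht htr => ?_⟩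
  · simp only [Finset.mem_union, Finset.mem_singleton, h.inter]
    constructor
    · rintro (h' | rfl) <;> tauto
    · rintro ⟨hu | hu, huS⟩
      · exact .inl ⟨hu, huS⟩
      · exact .inr ((hN u hu).1 huS)
  · rcases Finset.mem_union.1 hu with hu | hu
    · obtain ⟨t, ht, h'⟩ := h.attached u hu
      exact ⟨t, ht, h'.mono hmono⟩
    · rw [Finset.mem_singleton] at hu
      subst hu
      exact ⟨v, hvX, hvw.symm (hmono hvK)⟩
  · have htK := h.subset ht
    by_cases htv : G.Reach (s.K ∪ {w}) t v
    · exact .inl ⟨v, hvX, hv.ge, htv⟩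
    rcases h.passed t ht htr with ⟨t', ht', h1, h2⟩ | h'
    · exact .inl ⟨t', ht', h1, h2.mono hmono⟩
    · -- the component of `t` is not adjacent to `w`, so it does not change
      have hnw : ∀ y, G.Reach s.K t y → ¬ G.Adj y w := fun y hy hyw =>
        htv (((hy.mono hmono).tail hyw hwK').trans (hvw.symm (hmono hvK)))
      have hreach : ∀ y, G.Reach (s.K ∪ {w}) t y ↔ G.Reach s.K t y := by
        refine fun y => ⟨fun hy => ?_, fun hy => hy.mono hmono⟩
        refine Reach.of_closed (C := G.Reach s.K t) (fun p q hp hpq hq => ?_) hy .refl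
        rcases Finset.mem_union.1 hq with hq | hq
        · exact hp.tail hpq hq
        · rw [Finset.mem_singleton] at hq
          exact absurd (hq ▸ hpq) (hnw p hp)
      refine .inr fun hl => h' ?_
      obtain ⟨z, ⟨hzS, hzK, hz⟩, hz'⟩ := hl
      simp only [hreach, Finset.mem_union, Finset.mem_singleton, not_or] at hzK hz hz'
      refine ⟨z, ⟨hzS, hzK.1, hz⟩, ?_⟩
      rintro z' ⟨hS', hK', y, hy, hyz⟩
      exact hz' z' ⟨hS', ⟨hK', fun e => hnw y hy (e ▸ hyz)⟩, y, hy, hyz⟩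

/-- The interval length that belongs to `r` and `D`, when there are `u` free vertices. -/
def weight (X : Finset (Fin n)) (u r : ℕ) (D : Finset (Fin n)) : ℕ :=
  9 ^ (X.filter fun t => r ≤ t.val).card * (3 ^ Dᶜ.card * 2 ^ (u - Dᶜ.card))

theorem weight_succ_of_not_exists {X : Finset (Fin n)} {u r : ℕ} {D : Finset (Fin n)}
    (hr : ¬ ∃ v ∈ X, v.val = r) : weight X u (r + 1) D = weight X u r D := by
  have : (X.filter fun t => r + 1 ≤ t.val) = X.filter fun t => r ≤ t.val := by
    refine Finset.filter_congr fun t ht => ⟨fun h => by omega, fun h => ?_⟩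
    exact lt_of_le_of_ne h fun e => hr ⟨t, ht, e.symm⟩
  rw [weight, weight, this]

theorem weight_eq_nine_mul {X : Finset (Fin n)} {u r : ℕ} {D : Finset (Fin n)} {v : Fin n}
    (hvX : v ∈ X) (hv : v.val = r) : weight X u r D = 9 * weight X u (r + 1) D := by
  have : (X.filter fun t => r ≤ t.val) = insert v (X.filter fun t => r + 1 ≤ t.val) := by
    ext t
    simp only [Finset.mem_filter, Finset.mem_insert]
    constructor
    · rintro ⟨h, h'⟩
      rcases h'.lt_or_eq with h' | h'
      · exact .inr ⟨h, h'⟩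
      · exact .inl (Fin.ext (h'.symm.trans hv.symm))
    · rintro (rfl | h)
      · exact ⟨hvX, hv.ge⟩
      · exact ⟨h.1, by omega⟩
  rw [weight, weight, this, Finset.card_insert_of_notMem (by simp [hv])]
  ring

theorem weight_union {X : Finset (Fin n)} {u r : ℕ} {D N : Finset (Fin n)} (hN : Disjoint N D)
    (hu : Dᶜ.card ≤ u) : shrink (weight X u r D) N.card = weight X u r (D ∪ N) ∧
      9 * (N.card * weight X u r (D ∪ N)) ≤ 8 * weight X u r D := by
  have hcard : Dᶜ.card = (D ∪ N)ᶜ.card + N.card := by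
    rw [Finset.card_compl, Finset.card_compl, Finset.card_union_of_disjoint hN.symm]
    have := Finset.card_le_univ (D ∪ N)
    rw [Finset.card_union_of_disjoint hN.symm] at this
    omega
  have h2 : u - (D ∪ N)ᶜ.card = (u - Dᶜ.card) + N.card := by omega
  unfold weight
  rw [h2]
  generalize 9 ^ (X.filter fun t => r ≤ t.val).card = a
  rw [hcard]
  generalize (u - ((D ∪ N)ᶜ.card + N.card)) = c
  generalize (D ∪ N)ᶜ.card = b
  generalize N.card = d
  constructor
  · rw [show a * (3 ^ (b + d) * 2 ^ c) = (a * 2 ^ c) * 3 ^ (b + d) by ring, shrink_eq]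
    ring
  · calc 9 * (d * (a * (3 ^ b * 2 ^ (c + d)))) = (a * 3 ^ b * 2 ^ c) * (9 * (d * 2 ^ d)) := by ring
      _ ≤ (a * 3 ^ b * 2 ^ c) * (8 * 3 ^ d) := Nat.mul_le_mul_left _ (nine_mul_two_pow_le d)
      _ = _ := by ring

theorem two_pow_le_weight (X : Finset (Fin n)) {u r : ℕ} {D : Finset (Fin n)}
    (hu : Dᶜ.card ≤ u) : 2 ^ u ≤ weight X u r D := by
  calc 2 ^ u = 1 * (2 ^ Dᶜ.card * 2 ^ (u - Dᶜ.card)) := by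
        rw [one_mul, ← pow_add, Nat.add_sub_cancel' hu]
    _ ≤ _ := Nat.mul_le_mul (Nat.one_le_pow _ _ (by norm_num))
        (Nat.mul_le_mul_right _ (Nat.pow_le_pow_left (by norm_num) _))

/-- From every state on the way to `S`, the numbers that lead to `S` include an interval of length
`2 ^ u`. -/
theorem exists_interval {X S : Finset (Fin n)} (hS : G.Joined S S)
    (hmin : ∀ v ∈ S, v ∉ X → ¬ G.Joined (S.erase v) (S.erase v)) (hX : X.Nonempty) (u m : ℕ)
    (s : State n) (hs : G.OnTrack X S s) (hu : s.Dᶜ.card ≤ u) (hF : s.F = weight X u s.r s.D)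
    (hm : n - s.r + s.Dᶜ.card ≤ m) :
    ∃ p, p + 2 ^ u ≤ s.F ∧ ∀ I, p ≤ I → I < p + 2 ^ u →
      ((G.grow X)^[m] { s with I := I }).K = S := by
  induction m generalizing s with
  | zero =>
    refine ⟨0, by rw [hF, zero_add]; exact two_pow_le_weight X hu, fun I _ _ => ?_⟩
    exact hs.eq_of_le hS hmin hX (by omega)
  | succ m ih =>
    simp only [Function.iterate_succ_apply]
    by_cases hr : s.r < n
    swap
    · refine ⟨0, by rw [hF, zero_add]; exact two_pow_le_weight X hu, fun I _ _ => ?_⟩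
      have : ∀ I, G.grow X { s with I := I } = { s with I := I } := fun I => by simp [grow, hr]
      rw [this, Function.iterate_fixed (this I)]
      exact hs.eq_of_le hS hmin hX (by omega)
    by_cases hv : ∃ v ∈ X, v.val = s.r
    swap
    · obtain ⟨p, hp, h⟩ := ih { s with r := s.r + 1 } (hs.skip hv _ _) hu
        (by rw [hF]; exact (weight_succ_of_not_exists hv).symm) (by simp only; omega)
      refine ⟨p, hp, fun I h1 h2 => ?_⟩
      rw [show G.grow X { s with I := I } = { s with r := s.r + 1, I := I } by
        simp [grow, hr, hv]]
      exact h I h1 h2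
    have hv' := hv
    obtain ⟨v, hvX, hvr⟩ := hv'
    have h9 : s.F = 9 * weight X u (s.r + 1) s.D := hF.trans (weight_eq_nine_mul hvX hvr)
    by_cases hleaf : G.Leaf S s.K v
    swap
    · obtain ⟨p, hp, h⟩ := ih { s with r := s.r + 1, F := s.F / 9 } (hs.mark hvX hvr hleaf _ _) hu
        (by simp only; omega) (by simp only; omega)
      simp only at hp
      refine ⟨p, by omega, fun I h1 h2 => ?_⟩
      rw [show G.grow X { s with I := I } = { s with r := s.r + 1, I := I, F := s.F / 9 } by
        simp only [grow, hr, hv, if_true]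
        rw [if_pos (show I < s.F / 9 by omega)]]
      exact h I h1 h2
    · obtain ⟨w, ⟨hwS, hwK, x, hvx, hxw⟩, huniq⟩ := hleaf
      have hcomp : ∀ y, y ∈ G.comp s.K s.r ↔ G.Reach s.K v y := fun y => by
        rw [← hvr, mem_comp (hs.subset hvX)]
      set N := G.nbrs (G.comp s.K s.r) s.D with hNdef
      have hwN : w ∈ N := mem_nbrs.2 ⟨fun hwD => hwK ((hs.inter w).2 ⟨hwD, hwS⟩),
        x, (hcomp x).2 hvx, hxw⟩
      have hNS : ∀ y ∈ N, y ∈ S ↔ y = w := by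
        intro y hy
        obtain ⟨hyD, z, hz, hzy⟩ := mem_nbrs.1 hy
        refine ⟨fun hyS => huniq y ⟨hyS, fun h => hyD ((hs.inter y).1 h).1, z, (hcomp z).1 hz, hzy⟩,
          fun e => e ▸ hwS⟩
      have hdisj : Disjoint N s.D :=
        Finset.disjoint_left.2 fun y hy => (mem_nbrs.1 hy).1
      obtain ⟨hsh, hle⟩ := weight_union (X := X) (r := s.r) hdisj hu
      rw [← hF] at hsh hle
      have hcard : (s.D ∪ N)ᶜ.card + 1 ≤ s.Dᶜ.card := by
        refine Finset.card_lt_card (Finset.ssubset_iff_of_subset ?_ |>.2 ⟨w, ?_, ?_⟩)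
        · exact Finset.compl_subset_compl.2 Finset.subset_union_left
        · exact Finset.mem_compl.2 (mem_nbrs.1 hwN).1
        · simp [hwN]
      set F' := shrink s.F N.card with hF'
      obtain ⟨p, hp, h⟩ := ih ⟨s.K ∪ {w}, s.D ∪ N, s.r, 0, F'⟩
        (hs.extend hvX hvr hwS hwK ⟨x, hvx, hxw⟩ hNS hwN _ _) (by simp only; omega) hsh
        (by simp only; omega)
      simp only at hp h
      have hc := rank_lt_card hwN
      set c := rank N w with hcdef
      have hmul : (c + 1) * F' ≤ N.card * F' := Nat.mul_le_mul_right _ hc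
      rw [← hsh] at hle
      rw [Nat.add_mul, one_mul] at hmul
      -- in front of the interval of the `c`-th neighbour lie the first ninth and `c` intervals
      refine ⟨s.F / 9 + c * F' + p, by omega, fun I h1 h2 => ?_⟩
      obtain ⟨I', rfl⟩ : ∃ I', I = s.F / 9 + (c * F' + I') := ⟨I - s.F / 9 - c * F', by omega⟩
      have hI' : I' < F' := by omega
      have hdiv : (c * F' + I') / F' = c := by
        rw [Nat.add_comm, Nat.add_mul_div_right _ _ (by omega), Nat.div_eq_of_lt hI', zero_add]
      have hmod : (c * F' + I') % F' = I' := by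
        rw [Nat.add_comm, Nat.add_mul_mod_self_right, Nat.mod_eq_of_lt hI']
      have hsel : N.filter (fun y : Fin n => rank N y = c) = {w} := by
        ext y
        simp only [Finset.mem_filter, Finset.mem_singleton]
        exact ⟨fun hy => rank_injOn hy.1 hwN hy.2, fun e => e ▸ ⟨hwN, rfl⟩⟩
      rw [show G.grow X { s with I := s.F / 9 + (c * F' + I') } =
          ⟨s.K ∪ {w}, s.D ∪ N, s.r, I', F'⟩ by
        simp only [grow, hr, hv, if_true]
        rw [if_neg (by omega), ← hNdef, ← hF', Nat.add_sub_cancel_left, hdiv, hmod, hsel]]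
      exact h I' (by omega) (by omega)

/-- Completeness of the search: among the multiples of `2 ^ u` below the initial interval length,
where `u` is the number of free vertices, there is one that leads to a valid set. -/
theorem exists_joined_grown {X Y A : Finset (Fin n)} (hXY : Disjoint X Y) (hX : G.Joined A X)
    (hY : G.Joined Aᶜ Y) :
    ∃ j, j * 2 ^ (free X Y).card < 9 ^ X.card * 3 ^ (free X Y).card ∧
      G.Joined (G.grown X Y (j * 2 ^ (free X Y).card)) X ∧
      G.Joined (G.grown X Y (j * 2 ^ (free X Y).card))ᶜ Y := by
  classical
  set u := (free X Y).card with hu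
  -- a minimal connected set between `X` and `A`
  obtain ⟨S, ⟨hSA, hXS, hS⟩, hSmin⟩ : ∃ S, Minimal (fun S => S ⊆ A ∧ X ⊆ S ∧ G.Joined S S) S := by
    obtain ⟨C, h⟩ := hX.exists_connectedOn
    obtain ⟨S, -, hS⟩ := exists_minimal_le_of_wellFoundedLT
      (fun S => S ⊆ A ∧ X ⊆ S ∧ G.Joined S S) C h
    exact ⟨S, hS⟩
  have hmin : ∀ v ∈ S, v ∉ X → ¬ G.Joined (S.erase v) (S.erase v) := by
    intro v hv hvX hj
    have := hSmin ⟨(Finset.erase_subset _ _).trans hSA, Finset.subset_erase.2 ⟨hXS, hvX⟩, hj⟩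
      (Finset.erase_subset _ _)
    exact Finset.notMem_erase v S (this hv)
  suffices h : ∃ j, j * 2 ^ u < 9 ^ X.card * 3 ^ u ∧ G.grown X Y (j * 2 ^ u) = S by
    obtain ⟨j, hj, e⟩ := h
    refine ⟨j, hj, ?_, ?_⟩
    · rw [e]; exact hS.subset hXS
    · rw [e]; exact hY.mono (Finset.compl_subset_compl.2 hSA)
  rcases X.eq_empty_or_nonempty with rfl | hne
  · refine ⟨0, by rw [Nat.zero_mul]; positivity, ?_⟩
    have hS0 : S = ∅ := Finset.subset_empty.1
      (hSmin ⟨Finset.empty_subset _, subset_rfl, by simp [Joined]⟩ (Finset.empty_subset _))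
    -- without terminals the search only moves `r`
    have : ∀ m s, ((G.grow ∅)^[m] s).K = s.K := by
      intro m
      induction m with
      | zero => intro s; rfl
      | succ m ih =>
        intro s
        rw [Function.iterate_succ_apply, ih]
        simp only [grow, Finset.notMem_empty, false_and, exists_false, if_false]
        split_ifs <;> rfl
    rw [grown, this, hS0]; rfl
  have hYS : Disjoint S Y := Finset.disjoint_left.2 fun v hv hvY =>
    Finset.mem_compl.1 (hY.1 hvY) (hSA hv)
  have htrack : G.OnTrack X S (start X Y 0) := by
    refine ⟨subset_rfl, fun v => ?_, fun v hv => ⟨v, hv, .refl⟩, fun t _ h => ?_⟩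
    · simp only [start, Finset.mem_union]
      refine ⟨fun h => ⟨.inl h, hXS h⟩, ?_⟩
      rintro ⟨h | h, hvS⟩
      · exact h
      · exact absurd h (Finset.disjoint_left.1 hYS hvS)
    · exact absurd h (Nat.not_lt_zero _)
  obtain ⟨p, hp, h⟩ := exists_interval hS hmin hne u (2 * n) _ htrack le_rfl
    (by simp [start, weight, free, hu]) (by
      have := Finset.card_le_univ (start X Y 0).Dᶜ
      rw [Fintype.card_fin] at this
      simp only [start] at this ⊢
      omega)
  -- the interval contains a multiple of `2 ^ u`
  have hpos : 0 < 2 ^ u := by positivity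
  have hdm := Nat.div_add_mod (p + 2 ^ u - 1) (2 ^ u)
  have hml := Nat.mod_lt (p + 2 ^ u - 1) hpos
  rw [mul_comm] at hdm
  simp only [start, ← hu] at hp
  refine ⟨(p + 2 ^ u - 1) / 2 ^ u, by omega, ?_⟩
  exact h _ (by omega) (by omega)

end Grow
end SimpleGraph

namespace RAM

/-! ### Polynomial bounds for programs with bounded loops -/

/-- A memory content is `B`-bounded when the nonzero cells lie in the first 32 arrays at indices
below `B` and hold numbers of at most `B` bits. -/
def Bounded (B : ℕ) (σ : Store) : Prop :=
  ∀ k i, σ (k, i) < 2 ^ B ∧ (σ (k, i) ≠ 0 → k < 32 ∧ i < B)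

/-- A bound, as a polynomial in `B`, for the bit length of the value of an expression in a
`B`-bounded memory. -/
noncomputable def Expr.sizeBound : Expr → Polynomial ℕ
  | .lit c => .C c.size
  | .get _ _ => .X
  | .op _ e₁ e₂ => e₁.sizeBound + e₂.sizeBound + 1

/-- A bound, as a polynomial in `B`, for the cost of an expression in a `B`-bounded memory. -/
noncomputable def Expr.costBound : Expr → Polynomial ℕ
  | .lit c => .C (1 + c.size)
  | .get _ e => e.costBound + (1 + e.sizeBound + .X)
  | .op _ e₁ e₂ => e₁.costBound + e₂.costBound + (1 + e₁.sizeBound + e₂.sizeBound)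

/-- A bound, as a polynomial in `B`, for the time that a program takes when the memory stays
`B`-bounded and every loop is repeated at most `B` times. -/
noncomputable def Program.timeBound : Program → Polynomial ℕ
  | .skip => 1
  | .assign _ a e => a.costBound + e.costBound + (1 + a.sizeBound + e.sizeBound)
  | .seq P Q => P.timeBound + Q.timeBound
  | .ite b P Q => b.costBound + 1 + (P.timeBound + Q.timeBound)
  | .loop b P => (.X + 1) * (b.costBound + 1 + P.timeBound)

/-- A bound, as a polynomial in `B`, for the space of a `B`-bounded memory. -/
noncomputable def spaceBound : Polynomial ℕ := 32 * .X * (32 + 2 * .X)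

/-- The arrays to which a program assigns. -/
@[simp] def Program.writes : Program → List ℕ
  | .skip => []
  | .assign k _ _ => [k]
  | .seq P Q => P.writes ++ Q.writes
  | .ite _ P Q => P.writes ++ Q.writes
  | .loop _ P => P.writes

/-- `IterWhile b R m σ σ'`: exactly `m` repetitions of `R`, before each of which `b` holds, lead
from `σ` to `σ'`, where `b` fails. -/
def IterWhile (b : Expr) (R : Store → Store → Prop) : ℕ → Store → Store → Prop
  | 0, σ, σ' => b.eval σ = 0 ∧ σ' = σ
  | m + 1, σ, σ' => b.eval σ ≠ 0 ∧ ∃ τ, R σ τ ∧ IterWhile b R m τ σ'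

/-- `Exec B P σ σ'`: the program `P` leads from `σ` to `σ'` in such a way that every loop is
repeated at most `B` times whenever it is entered and all assignments are to indices below `B` and
of numbers below `2 ^ B`. -/
def Exec (B : ℕ) : Program → Store → Store → Prop
  | .skip, σ, σ' => σ' = σ
  | .assign k a e, σ, σ' =>
      a.eval σ < B ∧ e.eval σ < 2 ^ B ∧ σ' = σ.update (k, a.eval σ) (e.eval σ)
  | .seq P Q, σ, σ' => ∃ τ, Exec B P σ τ ∧ Exec B Q τ σ'
  | .ite b P Q, σ, σ' => (b.eval σ ≠ 0 ∧ Exec B P σ σ') ∨ (b.eval σ = 0 ∧ Exec B Q σ σ')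
  | .loop b P, σ, σ' => ∃ m ≤ B, IterWhile b (Exec B P) m σ σ'

theorem update_apply (σ : Store) (c d : ℕ × ℕ) (v : ℕ) :
    σ.update c v d = if d = c then v else σ d := by
  rw [Finsupp.coe_update, Function.update_apply]

theorem Exec.frame {B : ℕ} {P : Program} {σ σ' : Store} (h : Exec B P σ σ') {k : ℕ}
    (hk : k ∉ P.writes) (i : ℕ) : σ' (k, i) = σ (k, i) := by
  induction P generalizing σ σ' with
  | skip => rw [Exec] at h; rw [h]
  | assign k' a e =>
    rw [Exec] at h
    rw [h.2.2, update_apply, if_neg]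
    rintro ⟨⟩
    simp [Program.writes] at hk
  | seq P Q ihP ihQ =>
    rw [Exec] at h
    obtain ⟨τ, h1, h2⟩ := h
    simp only [Program.writes, List.mem_append, not_or] at hk
    rw [ihQ h2 hk.2, ihP h1 hk.1]
  | ite b P Q ihP ihQ =>
    rw [Exec] at h
    simp only [Program.writes, List.mem_append, not_or] at hk
    rcases h with h | h
    · exact ihP h.2 hk.1
    · exact ihQ h.2 hk.2
  | loop b P ih =>
    rw [Exec] at h
    obtain ⟨m, -, h⟩ := h
    induction m generalizing σ with
    | zero => rw [h.2]
    | succ m ihm =>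
      obtain ⟨-, τ, h1, h2⟩ := h
      rw [ihm h2, ih h1 hk]

theorem Op.size_eval_le (o : Op) (a b : ℕ) : (o.eval a b).size ≤ a.size + b.size + 1 := by
  have ha : a < 2 ^ a.size := Nat.lt_size_self a
  have hb : b < 2 ^ b.size := Nat.lt_size_self b
  have key : ∀ c, c ≤ a → c.size ≤ a.size + b.size + 1 := fun c hc =>
    (Nat.size_le_size hc).trans (by omega)
  have key1 : ∀ c, c ≤ 1 → c.size ≤ a.size + b.size + 1 := fun c hc =>
    (Nat.size_le_size hc).trans (by simp)
  cases o with
  | add =>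
    rw [Nat.size_le]
    have h1 : 2 ^ a.size ≤ 2 ^ (a.size + b.size) := Nat.pow_le_pow_right (by norm_num) (by omega)
    have h2 : 2 ^ b.size ≤ 2 ^ (a.size + b.size) := Nat.pow_le_pow_right (by norm_num) (by omega)
    rw [pow_succ]
    simp only [Op.eval]
    omega
  | sub => exact key _ (Nat.sub_le _ _)
  | mul =>
    rw [Nat.size_le]
    calc a * b < 2 ^ a.size * 2 ^ b.size := Nat.mul_lt_mul'' ha hb
      _ = 2 ^ (a.size + b.size) := (pow_add _ _ _).symm
      _ ≤ _ := Nat.pow_le_pow_right (by norm_num) (by omega)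
  | div => exact key _ (Nat.div_le_self _ _)
  | mod => exact key _ (Nat.mod_le _ _)
  | eq => exact key1 _ (by simp only [Op.eval]; split_ifs <;> omega)
  | lt => exact key1 _ (by simp only [Op.eval]; split_ifs <;> omega)

theorem Expr.size_eval_le {B : ℕ} {σ : Store} (h : Bounded B σ) (e : Expr) :
    (e.eval σ).size ≤ e.sizeBound.eval B := by
  induction e with
  | lit c => simp [Expr.eval, Expr.sizeBound]
  | get k e => simpa [Expr.eval, Expr.sizeBound, Nat.size_le] using (h k _).1
  | op o e₁ e₂ ih₁ ih₂ =>
    have := o.size_eval_le (e₁.eval σ) (e₂.eval σ)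
    simp only [Expr.eval, Expr.sizeBound, Polynomial.eval_add, Polynomial.eval_one]
    omega

theorem Expr.cost_le {B : ℕ} {σ : Store} (h : Bounded B σ) (e : Expr) :
    e.cost σ ≤ e.costBound.eval B := by
  induction e with
  | lit c => simp [Expr.cost, Expr.costBound]
  | get k e ih =>
    have h1 := e.size_eval_le h
    have h2 : (σ (k, e.eval σ)).size ≤ B := Nat.size_le.2 (h k _).1
    simp only [Expr.cost, Expr.costBound, Polynomial.eval_add, Polynomial.eval_one,
      Polynomial.eval_X]
    omega
  | op o e₁ e₂ ih₁ ih₂ =>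
    have h1 := e₁.size_eval_le h
    have h2 := e₂.size_eval_le h
    simp only [Expr.cost, Expr.costBound, Polynomial.eval_add, Polynomial.eval_one]
    omega

theorem Bounded.space_le {B : ℕ} {σ : Store} (h : Bounded B σ) :
    space σ ≤ spaceBound.eval B := by
  have hsub : σ.support ⊆ Finset.range 32 ×ˢ Finset.range B := by
    rintro ⟨k, i⟩ hc
    have := (h k i).2 (Finsupp.mem_support_iff.1 hc)
    simpa using this
  have hsize : ∀ a : ℕ, a.size ≤ a := fun a => Nat.size_le.2 Nat.lt_two_pow_self
  calc space σ ≤ ∑ _c ∈ σ.support, (32 + 2 * B) := by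
        refine Finset.sum_le_sum fun c hc => ?_
        obtain ⟨h1, h2⟩ := Finset.mem_product.1 (hsub hc)
        rw [Finset.mem_range] at h1 h2
        have h3 := hsize c.1
        have h4 := hsize c.2
        have h5 : (σ c).size ≤ B := Nat.size_le.2 (h c.1 c.2).1
        simp only
        omega
    _ = σ.support.card * (32 + 2 * B) := by simp
    _ ≤ (32 * B) * (32 + 2 * B) := by
        refine Nat.mul_le_mul_right _ ((Finset.card_le_card hsub).trans ?_)
        simp
    _ = _ := by simp [spaceBound]

theorem Bounded.update {B : ℕ} {σ : Store} (h : Bounded B σ) {k i v : ℕ} (hk : k < 32)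
    (hi : i < B) (hv : v < 2 ^ B) : Bounded B (σ.update (k, i) v) := by
  intro k' i'
  rw [update_apply]
  split_ifs with e
  · obtain ⟨rfl, rfl⟩ := Prod.mk.inj e
    exact ⟨hv, fun _ => ⟨hk, hi⟩⟩
  · exact h k' i'

/-- Bounded execution takes polynomial time and space. -/
theorem Exec.runs {B : ℕ} {P : Program} (hP : ∀ k ∈ P.writes, k < 32) {σ σ' : Store}
    (hσ : Bounded B σ) (h : Exec B P σ σ') :
    Bounded B σ' ∧ ∃ t s, Runs P σ σ' t s ∧ t ≤ P.timeBound.eval B ∧ s ≤ spaceBound.eval B := by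
  induction P generalizing σ σ' with
  | skip =>
    rw [Exec] at h
    subst h
    exact ⟨hσ, _, _, .skip _, by simp [Program.timeBound], hσ.space_le⟩
  | assign k a e =>
    rw [Exec] at h
    obtain ⟨h1, h2, rfl⟩ := h
    have hb := hσ.update (hP k (by simp [Program.writes])) h1 h2
    refine ⟨hb, _, _, .assign _ _ _ _, ?_, max_le hσ.space_le hb.space_le⟩
    have := a.cost_le hσ
    have := e.cost_le hσ
    have := a.size_eval_le hσ
    have := e.size_eval_le hσ
    simp only [Program.timeBound, Polynomial.eval_add, Polynomial.eval_one]
    omega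
  | seq P Q ihP ihQ =>
    rw [Exec] at h
    obtain ⟨τ, h1, h2⟩ := h
    simp only [Program.writes, List.mem_append] at hP
    obtain ⟨hτ, t, s, r, ht, hs⟩ := ihP (fun k hk => hP k (.inl hk)) hσ h1
    obtain ⟨hσ', t', s', r', ht', hs'⟩ := ihQ (fun k hk => hP k (.inr hk)) hτ h2
    refine ⟨hσ', _, _, r.seq r', ?_, max_le hs hs'⟩
    simp only [Program.timeBound, Polynomial.eval_add]
    omega
  | ite b P Q ihP ihQ =>
    rw [Exec] at h
    simp only [Program.writes, List.mem_append] at hP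
    have := b.cost_le hσ
    rcases h with ⟨hb, h⟩ | ⟨hb, h⟩
    · obtain ⟨hσ', t, s, r, ht, hs⟩ := ihP (fun k hk => hP k (.inl hk)) hσ h
      refine ⟨hσ', _, _, .ite_true hb r, ?_, hs⟩
      simp only [Program.timeBound, Polynomial.eval_add, Polynomial.eval_one]
      omega
    · obtain ⟨hσ', t, s, r, ht, hs⟩ := ihQ (fun k hk => hP k (.inr hk)) hσ h
      refine ⟨hσ', _, _, .ite_false hb r, ?_, hs⟩
      simp only [Program.timeBound, Polynomial.eval_add, Polynomial.eval_one]
      omega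
  | loop b P ih =>
    rw [Exec] at h
    obtain ⟨m, hm, h⟩ := h
    have key : Bounded B σ' ∧ ∃ t s, Runs (.loop b P) σ σ' t s ∧
        t ≤ (m + 1) * (b.costBound.eval B + 1 + P.timeBound.eval B) ∧
        s ≤ spaceBound.eval B := by
      clear hm
      induction m generalizing σ with
      | zero =>
        obtain ⟨hb, rfl⟩ := h
        refine ⟨hσ, _, _, .loop_done hb, ?_, hσ.space_le⟩
        have := b.cost_le hσ
        omega
      | succ m ihm =>
        obtain ⟨hb, τ, h1, h2⟩ := h
        obtain ⟨hτ, t, s, r, ht, hs⟩ := ih hP hσ h1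
        obtain ⟨hσ', t', s', r', ht', hs'⟩ := ihm hτ h2
        refine ⟨hσ', _, _, .loop_step hb r r', ?_, max_le hs hs'⟩
        have := b.cost_le hσ
        rw [Nat.add_mul _ 1]
        omega
    obtain ⟨hσ', t, s, r, ht, hs⟩ := key
    refine ⟨hσ', t, s, r, ht.trans ?_, hs⟩
    simp only [Program.timeBound, Polynomial.eval_add, Polynomial.eval_one, Polynomial.eval_mul,
      Polynomial.eval_X]
    exact Nat.mul_le_mul_right _ (by omega)

/-! ### Weakest preconditions -/

/-- From `σ` the program `P` leads by bounded execution to a memory with property `Q`. -/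
def Wp (B : ℕ) (P : Program) (Q : Store → Prop) (σ : Store) : Prop :=
  ∃ σ', Exec B P σ σ' ∧ Q σ'

/-- Outside the arrays in `W`, the memory contents `σ` and `τ` agree. -/
def Frame (W : List ℕ) (σ τ : Store) : Prop :=
  ∀ k, k ∉ W → ∀ i, τ (k, i) = σ (k, i)

theorem Frame.mono {W W' : List ℕ} {σ τ : Store} (h : Frame W σ τ) (hW : W ⊆ W') :
    Frame W' σ τ :=
  fun k hk => h k fun h' => hk (hW h')

theorem Frame.refl (W : List ℕ) (σ : Store) : Frame W σ σ :=
  fun _ _ _ => rfl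

theorem Frame.trans {W : List ℕ} {σ τ ρ : Store} (h : Frame W σ τ) (h' : Frame W τ ρ) :
    Frame W σ ρ :=
  fun k hk i => (h' k hk i).trans (h k hk i)

theorem Frame.update {W : List ℕ} {σ τ : Store} (h : Frame W σ τ) {k : ℕ} (hk : k ∈ W)
    (i v : ℕ) : Frame W σ (τ.update (k, i) v) := fun k' hk' i' => by
  rw [update_apply, if_neg, h k' hk' i']
  rintro ⟨⟩
  exact hk' hk

variable {B : ℕ} {P P' : Program} {Q Q' : Store → Prop} {σ : Store}

theorem wp_skip : Wp B .skip Q σ ↔ Q σ := by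
  simp [Wp, Exec]

theorem wp_assign {k : ℕ} {a e : Expr} : Wp B (.assign k a e) Q σ ↔
    a.eval σ < B ∧ e.eval σ < 2 ^ B ∧ Q (σ.update (k, a.eval σ) (e.eval σ)) := by
  simp only [Wp, Exec]
  constructor
  · rintro ⟨σ', ⟨h1, h2, rfl⟩, h⟩; exact ⟨h1, h2, h⟩
  · rintro ⟨h1, h2, h⟩; exact ⟨_, ⟨h1, h2, rfl⟩, h⟩

theorem wp_seq : Wp B (.seq P P') Q σ ↔ Wp B P (Wp B P' Q) σ := by
  simp only [Wp, Exec]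
  constructor
  · rintro ⟨σ', ⟨τ, h1, h2⟩, h⟩; exact ⟨τ, h1, σ', h2, h⟩
  · rintro ⟨τ, h1, σ', h2, h⟩; exact ⟨σ', ⟨τ, h1, h2⟩, h⟩

theorem wp_ite {b : Expr} : Wp B (.ite b P P') Q σ ↔
    (b.eval σ ≠ 0 → Wp B P Q σ) ∧ (b.eval σ = 0 → Wp B P' Q σ) := by
  simp only [Wp, Exec]
  by_cases hb : b.eval σ = 0 <;> simp [hb]

/-- The value of a scalar variable, which is an array that is only used at index `0`. -/
def var (k : ℕ) : Expr := .get k (.lit 0)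

/-- Assignment to a scalar variable. -/
def put (k : ℕ) (e : Expr) : Program := .assign k (.lit 0) e

/-- The loop that executes `P` for the values `0, …, b - 1` of the variable `i`. -/
def forTo (i : ℕ) (b : Expr) (P : Program) : Program :=
  .seq (put i (.lit 0))
    (.loop (.op .lt (var i) b) (.seq P (put i (.op .add (var i) (.lit 1)))))

@[simp] theorem put_writes (k : ℕ) (e : Expr) : (put k e).writes = [k] := rfl

@[simp] theorem forTo_writes (i : ℕ) (b : Expr) (P : Program) :
    (forTo i b P).writes = i :: (P.writes ++ [i]) := rfl

/-- The rule for counting loops, with an invariant `I` that does not speak about the counter. -/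
theorem wp_forTo {i N : ℕ} {b : Expr} (W : List ℕ) (I : ℕ → Store → Prop)
    (hW : i :: P.writes ⊆ W) (hi : i ∉ P.writes) (hN : N ≤ B) (hB : 0 < B)
    (hb : ∀ τ, Frame W σ τ → b.eval τ = N)
    (hI : ∀ j τ v, I j τ → I j (τ.update (i, 0) v)) (h0 : I 0 σ)
    (hs : ∀ j < N, ∀ τ, Frame W σ τ → τ (i, 0) = j → I j τ → Wp B P (I (j + 1)) τ)
    (hq : ∀ τ, Frame W σ τ → I N τ → Q τ) : Wp B (forTo i b P) Q σ := by
  have hpow : N < 2 ^ B := hN.trans_lt Nat.lt_two_pow_self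
  have hiW : i ∈ W := hW (by simp)
  have hPW : P.writes ⊆ W := fun k hk => hW (by simp [hk])
  have key : ∀ m j τ, j + m = N → Frame W σ τ → τ (i, 0) = j → I j τ →
      ∃ σ', IterWhile (.op .lt (var i) b)
        (Exec B (.seq P (put i (.op .add (var i) (.lit 1))))) m τ σ' ∧ Q σ' := by
    intro m
    induction m with
    | zero =>
      intro j τ hj hf hv h
      refine ⟨τ, ⟨?_, rfl⟩, hq τ hf (by rwa [← hj])⟩
      simp only [Expr.eval, var, Op.eval, hb τ hf, hv]
      rw [if_neg (by omega)]
    | succ m ihm =>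
      intro j τ hj hf hv h
      obtain ⟨τ', e1, h1⟩ := hs j (by omega) τ hf hv h
      have hf' : Frame W σ τ' := hf.trans fun k hk x => e1.frame (fun h => hk (hPW h)) x
      have hv' : τ' (i, 0) = j := by rw [e1.frame hi, hv]
      obtain ⟨σ', e2, h2⟩ := ihm (j + 1) (τ'.update (i, 0) (j + 1)) (by omega)
        (hf'.update hiW _ _) (by rw [update_apply, if_pos rfl]) (hI _ _ _ h1)
      refine ⟨σ', ⟨?_, _, ⟨τ', e1, ?_⟩, e2⟩, h2⟩
      · simp only [Expr.eval, var, Op.eval, hb τ hf, hv]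
        rw [if_pos (by omega)]
        exact one_ne_zero
      · simp only [put, Exec, Expr.eval, var, Op.eval, hv']
        exact ⟨hB, by omega, trivial⟩
  obtain ⟨σ', h1, h2⟩ := key N 0 (σ.update (i, 0) 0) (by omega)
    ((Frame.refl W σ).update hiW _ _) (by rw [update_apply, if_pos rfl]) (hI _ _ _ h0)
  refine ⟨σ', ?_, h2⟩
  rw [forTo, Exec]
  refine ⟨_, ?_, N, hN, h1⟩
  rw [put, Exec]
  exact ⟨hB, Nat.two_pow_pos B, rfl⟩

end RAM

namespace RAM

open SimpleGraph

/-! ### Programs on vertex sets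

The program uses the arrays
* `0` to `4` for the input and the output,
* `5` and `6` for the smaller terminal set `X` and the larger one `Y`,
* `7` for the candidate set, which is also the set `K` of the search, and `11` for its complement,
* `8` for the set `D` of the search, `9` for a component and `10` for its undecided neighbours,
* `12`, `13` and `14` for `2 ^ u`, the initial interval length and the number `j` of the round,
* `15`, `16` and `17` for the numbers `F`, `I` and `r` of the search,
* `18` and `19` for the number to be decoded and a counter,
* `20` and `21` for a vertex of a terminal set and a flag,
* `22` to `24` for loop counters, and `25` to `27` for the comparison of the terminal sets.
-/

instance : Add Expr := ⟨.op .add⟩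
instance : Sub Expr := ⟨.op .sub⟩
instance : Mul Expr := ⟨.op .mul⟩
instance : Div Expr := ⟨.op .div⟩
instance : Mod Expr := ⟨.op .mod⟩

section Eval

variable (σ : Store) (e e' : Expr) (k c : ℕ)

@[simp] theorem eval_add : (e + e').eval σ = e.eval σ + e'.eval σ := rfl
@[simp] theorem eval_sub : (e - e').eval σ = e.eval σ - e'.eval σ := rfl
@[simp] theorem eval_mul : (e * e').eval σ = e.eval σ * e'.eval σ := rfl
@[simp] theorem eval_div : (e / e').eval σ = e.eval σ / e'.eval σ := rfl
@[simp] theorem eval_mod : (e % e').eval σ = e.eval σ % e'.eval σ := rfl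
@[simp] theorem eval_lit : (Expr.lit c).eval σ = c := rfl
@[simp] theorem eval_lt : (Expr.op .lt e e').eval σ = if e.eval σ < e'.eval σ then 1 else 0 := rfl
@[simp] theorem eval_eq : (Expr.op .eq e e').eval σ = if e.eval σ = e'.eval σ then 1 else 0 := rfl
@[simp] theorem eval_var : (var k).eval σ = σ (k, 0) := rfl
@[simp] theorem eval_get : (Expr.get k e).eval σ = σ (k, e.eval σ) := rfl

end Eval

/-- Array `k` holds the indicator vector of `S`. -/
def Ind {n : ℕ} (σ : Store) (k : ℕ) (S : Finset (Fin n)) : Prop :=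
  ∀ v : Fin n, σ (k, v) = if v ∈ S then 1 else 0

open scoped Classical in
/-- The first two arrays hold the number of vertices and the adjacency matrix of `G`. -/
structure HasGraph {n : ℕ} (G : SimpleGraph (Fin n)) (σ : Store) : Prop where
  card : σ (0, 0) = n
  adj : ∀ u v : Fin n, σ (1, u * n + v) = if G.Adj u v then 1 else 0

variable {n B : ℕ} {G : SimpleGraph (Fin n)} {σ τ : Store} {k k' : ℕ} {W : List ℕ}
  {Q : Store → Prop} {S T X Y A C D N K : Finset (Fin n)}

theorem wp_put {e : Expr} : Wp B (put k e) Q σ ↔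
    0 < B ∧ e.eval σ < 2 ^ B ∧ Q (σ.update (k, 0) (e.eval σ)) := wp_assign

theorem Ind.frame (h : Ind σ k S) (hf : Frame W σ τ) (hk : k ∉ W) : Ind τ k S :=
  fun v => by rw [hf k hk, h v]

theorem Ind.update_of_ne (h : Ind σ k S) (hk : k ≠ k') (i v : ℕ) :
    Ind (σ.update (k', i) v) k S := fun w => by
  rw [update_apply, if_neg (fun e => hk (Prod.mk.inj e).1), h w]

theorem Ind.update (h : Ind σ k S) (y : Fin n) {b : ℕ} (hb : b = if y ∈ T then 1 else 0)
    (hT : ∀ v, v ≠ y → (v ∈ T ↔ v ∈ S)) : Ind (σ.update (k, y) b) k T := fun v => by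
  rw [update_apply]
  by_cases hv : v = y
  · subst hv
    rw [if_pos rfl, hb]
  · rw [if_neg (fun e => hv (Fin.ext (Prod.mk.inj e).2)), h v]
    simp only [hT v hv]

theorem HasGraph.frame (h : HasGraph G σ) (hf : Frame W σ τ) (h0 : 0 ∉ W) (h1 : 1 ∉ W) :
    HasGraph G τ :=
  ⟨by rw [hf 0 h0, h.card], fun u v => by rw [hf 1 h1, h.adj u v]⟩

theorem exists_edge {e : ℕ} (he : e < n * n) :
    ∃ x y : Fin n, e = x * n + y ∧ e / n = x ∧ e % n = y := by
  have hn : 0 < n := Nat.pos_of_ne_zero (by rintro rfl; simp at he)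
  refine ⟨⟨e / n, Nat.div_lt_of_lt_mul he⟩, ⟨e % n, Nat.mod_lt _ hn⟩, ?_, rfl, rfl⟩
  rw [mul_comm]
  exact (Nat.div_add_mod e n).symm

theorem edge_lt (x y : Fin n) : x.val * n + y < n * n := by
  have := Nat.mul_le_mul_right n (Nat.succ_le_of_lt x.isLt)
  rw [Nat.succ_mul] at this
  have := y.isLt
  omega

theorem edge_inj {x y x' y' : Fin n} (h : x.val * n + y = x' * n + y') : x = x' ∧ y = y' := by
  have hn : 0 < n := x.pos
  have h1 := congrArg (· / n) h
  have h2 := congrArg (· % n) h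
  simp only [mul_comm _ n, Nat.mul_add_div hn, Nat.mul_add_mod, Nat.div_eq_of_lt y.isLt,
    Nat.div_eq_of_lt y'.isLt, Nat.mod_eq_of_lt y.isLt, Nat.mod_eq_of_lt y'.isLt, add_zero] at h1 h2
  exact ⟨Fin.ext h1, Fin.ext h2⟩

/-- The loop over the vertices that sets cell `v` of array `k` to the value of `e`. -/
def fill (k : ℕ) (e : Expr) : Program := forTo 22 (var 0) (.assign k (var 22) e)

theorem wp_fill {e : Expr} (hB : n < B) (hσ : σ (0, 0) = n) (hk : k ≠ 22) (hk0 : k ≠ 0)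
    (he : ∀ (v : Fin n) τ, Frame [22, k] σ τ → τ (22, 0) = v → e.eval τ = if v ∈ S then 1 else 0)
    (hQ : ∀ τ, Frame [22, k] σ τ → Ind τ k S → Q τ) : Wp B (fill k e) Q σ := by
  refine wp_forTo (N := n) [22, k]
    (fun j τ => ∀ v : Fin n, v.val < j → τ (k, v) = if v ∈ S then 1 else 0)
    (by simp) (by simpa using hk.symm) hB.le (by omega) ?_ ?_ (fun _ h => absurd h (by omega)) ?_
    (fun τ hf h => hQ τ hf fun v => h v v.isLt)
  · intro τ hf
    rw [eval_var, hf 0 (by simpa using hk0.symm), hσ]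
  · intro j τ v h w hw
    rw [update_apply, if_neg (by simp [hk]), h w hw]
  · intro j hj τ hf hv h
    have hval := he ⟨j, hj⟩ τ hf hv
    rw [wp_assign, eval_var, hv, hval]
    refine ⟨by omega, ?_, ?_⟩
    · have : 1 < 2 ^ B := Nat.one_lt_two_pow (by omega)
      split_ifs <;> omega
    · intro w hw
      rw [update_apply]
      by_cases hwj : w.val = j
      · obtain rfl : w = ⟨j, hj⟩ := Fin.ext hwj
        rw [if_pos rfl]
      · rw [if_neg (by simpa using hwj), h w (by omega)]

/-- Close the set in array `9` under stepping to neighbours in the set in array `a`. -/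
def closure (a : ℕ) : Program :=
  forTo 22 (var 0 + .lit 1) <| forTo 23 (var 0 * var 0) <|
    .assign 9 (var 23 % var 0) <| .op .lt (.lit 0) <| .get 9 (var 23 % var 0) +
      .get 9 (var 23 / var 0) * .get 1 (var 23) * .get a (var 23 % var 0)

theorem wp_closure {a : ℕ} (ha : a ∉ [22, 23, 9]) (hB : n * n + n + 1 < B) (hG : HasGraph G σ)
    (hA : Ind σ a A) (hC : Ind σ 9 C) (hR : ∀ y, y ∈ S ↔ ∃ x ∈ C, G.Reach A x y)
    (hQ : ∀ τ, Frame [22, 23, 9] σ τ → Ind τ 9 S → Q τ) : Wp B (closure a) Q σ := by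
  have hCS : C ⊆ S := fun x hx => (hR x).2 ⟨x, hx, .refl⟩
  have hSA : ∀ x y, x ∈ S → G.Adj x y → y ∈ A → y ∈ S := fun x y hx hxy hy => by
    obtain ⟨z, hz, h⟩ := (hR x).1 hx
    exact (hR y).2 ⟨z, hz, h.tail hxy hy⟩
  have h1B : 1 < 2 ^ B := Nat.one_lt_two_pow (by omega)
  -- each round adds a vertex until the closure is reached
  refine wp_forTo (N := n + 1) [22, 23, 9] (fun j τ => ∃ C', Ind τ 9 C' ∧ C ⊆ C' ∧ C' ⊆ S ∧
    (S ⊆ C' ∨ j ≤ C'.card)) (by simp) (by simp) (by omega) (by omega) ?_ ?_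
    ⟨C, hC, subset_rfl, hCS, .inr (Nat.zero_le _)⟩ ?_ ?_
  · intro τ hf
    rw [eval_add, eval_var, eval_lit, hf 0 (by decide), hG.card]
  · rintro j τ v ⟨C', h, h'⟩
    exact ⟨C', h.update_of_ne (by decide) _ _, h'⟩
  · rintro j - τ hf - ⟨C₁, hC₁, hCC₁, hC₁S, hprog⟩
    have hGτ : HasGraph G τ := hG.frame hf (by decide) (by decide)
    have hAτ : Ind τ a A := hA.frame hf ha
    refine wp_forTo (N := n * n) [22, 23, 9] (fun j τ => ∃ C', Ind τ 9 C' ∧ C₁ ⊆ C' ∧ C' ⊆ S ∧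
      ∀ x y : Fin n, x.val * n + y < j → x ∈ C₁ → G.Adj x y → y ∈ A → y ∈ C') (by simp) (by simp)
      (by omega) (by omega) ?_ ?_ ⟨C₁, hC₁, subset_rfl, hC₁S, fun _ _ h => absurd h (by omega)⟩
      ?_ ?_
    · intro τ' hf'
      rw [eval_mul, eval_var, hf' 0 (by decide), hGτ.card]
    · rintro j τ v ⟨C', h, h'⟩
      exact ⟨C', h.update_of_ne (by decide) _ _, h'⟩
    · rintro e he τ' hf' hv ⟨C', hC', hCC', hC'S, hedge⟩
      have hGτ' : HasGraph G τ' := hGτ.frame hf' (by decide) (by decide)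
      have hAτ' : Ind τ' a A := hAτ.frame hf' ha
      obtain ⟨x, y, hxy, hx, hy⟩ := exists_edge he
      simp only [wp_assign, eval_mod, eval_div, eval_var, eval_lt, eval_get, eval_add, eval_mul,
        eval_lit, hGτ'.card, hv, hx, hy]
      rw [hC' x, hC' y, hAτ' y, hxy, hGτ'.adj x y]
      refine ⟨by have := y.isLt; omega, by split_ifs <;> omega, ?_⟩
      classical
      by_cases hc : x ∈ C' ∧ G.Adj x y ∧ y ∈ A
      · refine ⟨insert y C', hC'.update y (by simp [hc.1, hc.2.1, hc.2.2]) (by simp +contextual),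
          hCC'.trans (Finset.subset_insert _ _), ?_, ?_⟩
        · exact Finset.insert_subset (hSA x y (hC'S hc.1) hc.2.1 hc.2.2) hC'S
        · intro x' y' hlt hx' hadj hy'
          rcases Nat.lt_succ_iff_lt_or_eq.1 hlt with hlt | heq
          · exact Finset.mem_insert_of_mem (hedge x' y' (by omega) hx' hadj hy')
          · rw [(edge_inj heq).2]
            exact Finset.mem_insert_self _ _
      · refine ⟨C', hC'.update y ?_ (by simp), hCC', hC'S, ?_⟩
        · clear hedge hSA
          by_cases h1 : x ∈ C' <;> by_cases h2 : G.Adj x y <;> by_cases h3 : y ∈ A <;>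
            by_cases h4 : y ∈ C' <;> simp_all
        · intro x' y' hlt hx' hadj hy'
          rcases Nat.lt_succ_iff_lt_or_eq.1 hlt with hlt | heq
          · exact hedge x' y' (by omega) hx' hadj hy'
          · obtain ⟨rfl, rfl⟩ := edge_inj heq
            exact absurd ⟨hCC' hx', hadj, hy'⟩ hc
    · rintro τ' - ⟨C', hC', hCC', hC'S, hedge⟩
      refine ⟨C', hC', hCC₁.trans hCC', hC'S, ?_⟩
      by_cases hcl : S ⊆ C₁
      · exact .inl (hcl.trans hCC')
      · have hj := hprog.resolve_left hcl
        refine .inr (Nat.succ_le_of_lt (hj.trans_lt (Finset.card_lt_card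
          ⟨hCC', fun hsub => hcl fun y hy => ?_⟩)))
        -- a round without progress means that the closure has been reached
        obtain ⟨x, hx, h⟩ := (hR y).1 hy
        exact h.of_closed (C := (· ∈ C₁))
          (fun p q hp hpq hq => hsub (hedge p q (edge_lt p q) hp hpq hq)) (hCC₁ hx)
  · rintro τ hf ⟨C', hC', -, hC'S, hfin⟩
    have hcard := Finset.card_le_univ C'
    rw [Fintype.card_fin] at hcard
    rcases hfin with h | h
    · exact hQ τ hf (hC'S.antisymm h ▸ hC')
    · omega

/-- Store the component of vertex `s` in the graph induced by array `a` in array `9`. -/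
def component (a : ℕ) (s : Expr) : Program :=
  .seq (fill 9 (.op .eq (var 22) s * .get a (var 22))) (closure a)

theorem wp_component {a s : ℕ} (ha : a ∉ [22, 23, 9]) (hs : s ∉ [22, 23, 9])
    (hB : n * n + n + 1 < B) (hG : HasGraph G σ) (hA : Ind σ a A)
    (hQ : ∀ τ, Frame [22, 23, 9] σ τ → Ind τ 9 (G.comp A (σ (s, 0))) → Q τ) :
    Wp B (component a (var s)) Q σ := by
  have hW : [22, 9] ⊆ [22, 23, 9] := by decide
  rw [component, wp_seq]
  refine wp_fill (S := A.filter fun v => v.val = σ (s, 0)) (by omega) hG.card (by decide)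
    (by decide) ?_ ?_
  · intro v τ hf hv
    rw [eval_mul, eval_eq, eval_get, eval_var, eval_var, hv, hf.mono hW s hs, hf.mono hW a ha, hA v]
    by_cases h1 : v.val = σ (s, 0) <;> by_cases h2 : v ∈ A <;> simp [h1, h2]
  · intro τ hf hC
    have hf := hf.mono hW
    refine wp_closure ha hB (hG.frame hf (by decide) (by decide)) (hA.frame hf ha) hC ?_
      (fun τ' hf' h => hQ τ' (hf.trans hf') h)
    intro y
    simp only [comp, Finset.mem_filter, Finset.mem_univ, true_and, and_assoc]

/-- Reset the flag in array `21` unless the vertices in array `x` lie in a single component of the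
graph induced by array `a`. -/
def check (a x : ℕ) : Program :=
  .seq (put 20 (.lit 0)) <| .seq
    (forTo 22 (var 0) <| .ite (.get x (var 22)) (put 20 (var 22)) .skip) <| .seq
    (component a (var 20)) <|
    forTo 22 (var 0) <|
      .ite (.get x (var 22) * .op .eq (.get 9 (var 22)) (.lit 0)) (put 21 (.lit 0)) .skip

theorem joined_iff_subset_comp {s : ℕ} (hs : X.Nonempty → ∃ v ∈ X, v.val = s) :
    G.Joined A X ↔ X ⊆ G.comp A s := by
  constructor
  · rintro ⟨h1, h2⟩ y hy
    obtain ⟨v, hv, rfl⟩ := hs ⟨y, hy⟩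
    exact (mem_comp (h1 hv)).2 (h2 v hv y hy)
  · intro h
    have key : ∀ y ∈ X, ∃ v ∈ A, v.val = s ∧ G.Reach A v y := fun y hy => by
      have := h hy
      simpa only [comp, Finset.mem_filter, Finset.mem_univ, true_and] using this
    refine ⟨fun y hy => ?_, fun y hy z hz => ?_⟩
    · obtain ⟨v, hv, -, hvy⟩ := key y hy
      exact hvy.mem hv
    · obtain ⟨v, hv, hvs, hvy⟩ := key y hy
      obtain ⟨v', -, hvs', hvz⟩ := key z hz
      obtain rfl : v = v' := Fin.ext (hvs.trans hvs'.symm)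
      exact (hvy.symm hv).trans hvz

theorem forall_lt_succ_iff {p : Fin n → Prop} {j : ℕ} (hj : j < n) :
    (∀ v : Fin n, v.val < j + 1 → p v) ↔ (∀ v : Fin n, v.val < j → p v) ∧ p ⟨j, hj⟩ := by
  refine ⟨fun h => ⟨fun v hv => h v (by omega), h _ (Nat.lt_succ_self j)⟩, fun h v hv => ?_⟩
  rcases Nat.lt_succ_iff_lt_or_eq.1 hv with hv | rfl
  · exact h.1 v hv
  · exact h.2

theorem wp_check {a x : ℕ} (ha : a ∉ [20, 21, 22, 23, 9]) (hx : x ∉ [20, 21, 22, 23, 9])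
    (hB : n * n + n + 1 < B) (hG : HasGraph G σ) (hA : Ind σ a A) (hX : Ind σ x X)
    (hQ : ∀ τ, Frame [20, 21, 22, 23, 9] σ τ →
      (τ (21, 0) ≠ 0 ↔ σ (21, 0) ≠ 0 ∧ G.Joined A X) → Q τ) : Wp B (check a x) Q σ := by
  have hW : [22, 23, 9] ⊆ [20, 21, 22, 23, 9] := by decide
  have ha' : a ∉ [22, 23, 9] := fun h => ha (hW h)
  have hpow : B < 2 ^ B := Nat.lt_two_pow_self
  rw [check, wp_seq, wp_put]
  refine ⟨by omega, by simp, ?_⟩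
  have hf0 := (Frame.refl [20, 22] σ).update (k := 20) (by decide) 0 ((Expr.lit 0).eval σ)
  rw [wp_seq]
  refine wp_forTo (N := n) [20, 22]
    (fun j τ => (∃ v ∈ X, v.val < j) → ∃ v ∈ X, v.val = τ (20, 0))
    (by simp) (by simp) (by omega) (by omega) ?_ ?_ ?_ ?_ ?_
  · intro τ hf
    rw [eval_var, (hf0.trans hf) 0 (by decide), hG.card]
  · intro j τ v h
    rwa [update_apply, if_neg (by simp)]
  · rintro ⟨v, -, h⟩
    omega
  · intro j hj τ hf hv h
    have hX' : τ (x, j) = if (⟨j, hj⟩ : Fin n) ∈ X then 1 else 0 := by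
      rw [(hf0.trans hf) x (by simp at hx; simp [hx])]
      exact hX ⟨j, hj⟩
    rw [wp_ite, wp_skip, wp_put, eval_get, eval_var, hv, hX']
    constructor
    · intro hne
      have hjX : (⟨j, hj⟩ : Fin n) ∈ X := by by_contra hc; simp [hc] at hne
      refine ⟨by omega, by omega, fun _ => ⟨_, hjX, ?_⟩⟩
      rw [update_apply, if_pos rfl]
    · rintro hz ⟨v, hvX, hlt⟩
      have hjX : (⟨j, hj⟩ : Fin n) ∉ X := by intro hc; simp [hc] at hz
      refine h ⟨v, hvX, lt_of_le_of_ne (Nat.lt_succ_iff.1 hlt) ?_⟩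
      rintro rfl
      exact hjX hvX
  · intro τ hf h
    have hf1 : Frame [20, 21, 22, 23, 9] σ τ := (hf0.trans hf).mono (by decide)
    have h21 : τ (21, 0) = σ (21, 0) := (hf0.trans hf) 21 (by decide) 0
    rw [wp_seq]
    refine wp_component ha' (by decide) hB (hG.frame hf1 (by decide) (by decide))
      (hA.frame hf1 ha) ?_
    intro τ' hf' hC
    have hf2 : Frame [20, 21, 22, 23, 9] σ τ' := hf1.trans (hf'.mono hW)
    have h21' : τ' (21, 0) = σ (21, 0) := (hf' 21 (by decide) 0).trans h21
    have hJ : G.Joined A X ↔ X ⊆ G.comp A (τ (20, 0)) :=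
      joined_iff_subset_comp fun ⟨v, hv⟩ => h ⟨v, hv, v.isLt⟩
    generalize G.comp A (τ (20, 0)) = C at hC hJ
    refine wp_forTo (N := n) [21, 22] (fun j τ'' => τ'' (21, 0) ≠ 0 ↔ σ (21, 0) ≠ 0 ∧
      ∀ v : Fin n, v.val < j → v ∈ X → v ∈ C) (by simp) (by simp) (by omega) (by omega) ?_ ?_
      (by simp [h21']) ?_ ?_
    · intro τ'' hf''
      rw [eval_var, hf'' 0 (by decide), hf2 0 (by decide), hG.card]
    · intro j τ'' v h
      rwa [update_apply, if_neg (by simp)]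
    · intro j hj τ'' hf'' hv hI
      have hX' : τ'' (x, j) = if (⟨j, hj⟩ : Fin n) ∈ X then 1 else 0 := by
        rw [hf'' x (by simp at hx; simp [hx]), hf2 x hx]
        exact hX ⟨j, hj⟩
      have hC' : τ'' (9, j) = if (⟨j, hj⟩ : Fin n) ∈ C then 1 else 0 := by
        rw [hf'' 9 (by decide)]
        exact hC ⟨j, hj⟩
      rw [wp_ite, wp_skip, wp_put, eval_mul, eval_eq, eval_get, eval_get, eval_var, eval_lit, hv,
        hX', hC', forall_lt_succ_iff hj]
      by_cases h1 : (⟨j, hj⟩ : Fin n) ∈ X <;> by_cases h2 : (⟨j, hj⟩ : Fin n) ∈ C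
      · simpa [h1, h2] using hI
      · simp only [h1, h2, update_apply]
        simp
        omega
      · simpa [h1, h2] using hI
      · simpa [h1, h2] using hI
    · intro τ'' hf'' hI
      refine hQ τ'' (hf2.trans (hf''.mono (by decide))) ?_
      rw [hI, hJ]
      exact and_congr_right fun _ => ⟨fun h v hv => h v v.isLt hv, fun h v _ hv => h hv⟩

/-! ### Testing and decoding candidates -/

/-- The sets `A` and `Aᶜ` solve the problem. -/
def Solves (G : SimpleGraph (Fin n)) (X Y A : Finset (Fin n)) : Prop :=
  G.Joined A X ∧ G.Joined Aᶜ Y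

/-- Set the output to `1` if the set in array `7` is the first part of a solution. -/
def test : Program :=
  .seq (fill 11 (.op .eq (.get 7 (var 22)) (.lit 0))) <| .seq (put 21 (.lit 1)) <|
    .seq (check 7 5) <| .seq (check 11 6) <| .ite (var 21) (put 4 (.lit 1)) .skip

open scoped Classical in
theorem wp_test (hB : n * n + n + 1 < B) (hG : HasGraph G σ) (hX : Ind σ 5 X) (hY : Ind σ 6 Y)
    (hA : Ind σ 7 A) (hQ : ∀ τ, Frame [4, 9, 11, 20, 21, 22, 23] σ τ →
      τ (4, 0) = (if Solves G X Y A then 1 else σ (4, 0)) → Q τ) :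
    Wp B test Q σ := by
  have h1B : 1 < 2 ^ B := Nat.one_lt_two_pow (by omega)
  have hW : [20, 21, 22, 23, 9] ⊆ [4, 9, 11, 20, 21, 22, 23] := by decide
  rw [test, wp_seq]
  refine wp_fill (S := Aᶜ) (by omega) hG.card (by decide) (by decide) ?_ ?_
  · intro v τ hf hv
    rw [eval_eq, eval_get, eval_var, hv, hf 7 (by decide), hA v]
    by_cases h : v ∈ A <;> simp [h]
  intro τ₁ hf₁ hc₁
  rw [wp_seq, wp_put]
  refine ⟨by omega, h1B, ?_⟩
  have hf₂ : Frame [4, 9, 11, 20, 21, 22, 23] σ (τ₁.update (21, 0) ((Expr.lit 1).eval τ₁)) :=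
    (hf₁.mono (by decide)).update (by decide) _ _
  have hc₂ := hc₁.update_of_ne (k' := 21) (by decide) 0 ((Expr.lit 1).eval τ₁)
  have hv₂ : τ₁.update (21, 0) ((Expr.lit 1).eval τ₁) (21, 0) = 1 := by
    rw [update_apply, if_pos rfl, eval_lit]
  have hout₂ : τ₁.update (21, 0) ((Expr.lit 1).eval τ₁) (4, 0) = σ (4, 0) := by
    rw [update_apply, if_neg (by decide), hf₁ 4 (by decide)]
  generalize τ₁.update (21, 0) ((Expr.lit 1).eval τ₁) = τ₂ at hf₂ hc₂ hv₂ hout₂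
  rw [wp_seq]
  refine wp_check (by decide) (by decide) hB (hG.frame hf₂ (by decide) (by decide))
    (hA.frame hf₂ (by decide)) (hX.frame hf₂ (by decide)) ?_
  intro τ₃ hf₃ hj₃
  have hf₃' := hf₂.trans (hf₃.mono hW)
  rw [wp_seq]
  refine wp_check (by decide) (by decide) hB (hG.frame hf₃' (by decide) (by decide))
    (hc₂.frame hf₃ (by decide)) (hY.frame hf₃' (by decide)) ?_
  intro τ₄ hf₄ hj₄
  have hf₄' := hf₃'.trans (hf₄.mono hW)
  have hout : τ₄ (4, 0) = σ (4, 0) := by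
    rw [hf₄ 4 (by decide), hf₃ 4 (by decide), hout₂]
  rw [hv₂] at hj₃
  rw [hj₃] at hj₄
  simp only [ne_eq, one_ne_zero, not_false_eq_true, true_and] at hj₄
  have hj₄ : τ₄ (21, 0) ≠ 0 ↔ Solves G X Y A := hj₄
  rw [wp_ite, wp_put, wp_skip, eval_var]
  constructor
  · intro h
    refine ⟨by omega, h1B, hQ _ (hf₄'.update (by decide) _ _) ?_⟩
    rw [update_apply, if_pos rfl, if_pos (hj₄.1 h), eval_lit]
  · intro h
    exact hQ _ hf₄' (by rw [if_neg (fun h' => hj₄.2 h' h), hout])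

/-- Decode the number in cell `14[0]` bit by bit into a vertex set in array `7`. -/
def decode : Program :=
  .seq (put 18 (var 14)) <| forTo 22 (var 0) <| .ite (.get 5 (var 22) + .get 6 (var 22))
    (.assign 7 (var 22) (.get 5 (var 22)))
    (.seq (.assign 7 (var 22) (var 18 % .lit 2)) (put 18 (var 18 / .lit 2)))

theorem wp_decode (hB : n < B) (hG : HasGraph G σ) (hX : Ind σ 5 X) (hY : Ind σ 6 Y)
    (hj : σ (14, 0) < 2 ^ B)
    (hQ : ∀ τ, Frame [7, 18, 22] σ τ → Ind τ 7 (bitSet X Y (σ (14, 0))) → Q τ) :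
    Wp B decode Q σ := by
  have h1B : 1 < 2 ^ B := Nat.one_lt_two_pow (by omega)
  rw [decode, wp_seq, wp_put]
  refine ⟨by omega, hj, ?_⟩
  have hf0 : Frame [7, 18, 22] σ (σ.update (18, 0) ((var 14).eval σ)) :=
    (Frame.refl _ σ).update (by decide) _ _
  refine wp_forTo (N := n) [7, 18, 22] (fun v τ => τ (18, 0) = σ (14, 0) / 2 ^ rank (free X Y) v ∧
    ∀ w : Fin n, w.val < v → τ (7, w) = if w ∈ bitSet X Y (σ (14, 0)) then 1 else 0)
    (by simp) (by simp) (by omega) (by omega) ?_ ?_ ?_ ?_ ?_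
  · intro τ hf
    rw [eval_var, (hf0.trans hf) 0 (by decide), hG.card]
  · rintro v τ i ⟨h1, h2⟩
    exact ⟨by rwa [update_apply, if_neg (by simp)], fun w hw => by
      rw [update_apply, if_neg (by simp), h2 w hw]⟩
  · exact ⟨by simp [update_apply, rank_zero], fun w hw => absurd hw (by omega)⟩
  · rintro v hv τ hf hcount ⟨hq, hdone⟩
    have hf' := hf0.trans hf
    have h5 : τ (5, v) = if (⟨v, hv⟩ : Fin n) ∈ X then 1 else 0 :=
      (hf' 5 (by decide) v).trans (hX ⟨v, hv⟩)
    have h6 : τ (6, v) = if (⟨v, hv⟩ : Fin n) ∈ Y then 1 else 0 :=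
      (hf' 6 (by decide) v).trans (hY ⟨v, hv⟩)
    have hstep : ∀ (τ' : Store) (b : ℕ), (∀ i, τ' (7, i) = if i = v then b else τ (7, i)) →
        b = (if (⟨v, hv⟩ : Fin n) ∈ bitSet X Y (σ (14, 0)) then 1 else 0) →
        ∀ w : Fin n, w.val < v + 1 →
          τ' (7, w) = if w ∈ bitSet X Y (σ (14, 0)) then 1 else 0 := by
      intro τ' b hτ' hb w hw
      rw [hτ' w]
      by_cases hwv : w.val = v
      · obtain rfl : w = ⟨v, hv⟩ := Fin.ext hwv
        rw [if_pos rfl, hb]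
      · rw [if_neg hwv, hdone w (by omega)]
    rw [wp_ite, wp_assign, wp_seq, wp_assign, wp_put]
    simp only [eval_add, eval_get, eval_var, eval_mod, eval_div, eval_lit, hcount, h5, h6]
    by_cases hfree : (⟨v, hv⟩ : Fin n) ∈ free X Y
    · have hfree' := hfree
      simp only [free, Finset.mem_compl, Finset.mem_union, not_or] at hfree'
      have hr := rank_succ_of_mem hfree
      simp only at hr
      refine ⟨fun h => absurd h (by simp [hfree'.1, hfree'.2]), fun _ =>
        ⟨by omega, by omega, by omega, ?_, ?_, ?_⟩⟩
      · rw [update_apply, if_neg (by simp), hq]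
        exact ((Nat.div_le_self _ _).trans (Nat.div_le_self _ _)).trans_lt hj
      · rw [update_apply, if_pos rfl, update_apply, if_neg (by simp), hq, hr, pow_succ,
          Nat.div_div_eq_div_mul]
      · refine hstep _ (τ (18, 0) % 2) (fun i => ?_) ?_
        · rw [update_apply, if_neg (by simp), update_apply]
          simp
        · have hmem : (⟨v, hv⟩ : Fin n) ∈ bitSet X Y (σ (14, 0)) ↔
              (σ (14, 0)).testBit (rank (free X Y) v) := by
            simp only [bitSet, Finset.mem_union, Finset.mem_filter, hfree, hfree'.1, true_and,
              false_or]
          rw [hq]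
          simp only [hmem, Nat.testBit_eq_decide_div_mod_eq, decide_eq_true_iff]
          split_ifs <;> omega
    · have hr := rank_succ_of_notMem hfree
      simp only at hr
      have hmem : (⟨v, hv⟩ : Fin n) ∈ bitSet X Y (σ (14, 0)) ↔ (⟨v, hv⟩ : Fin n) ∈ X := by
        simp [bitSet, hfree]
      have hfree' : (⟨v, hv⟩ : Fin n) ∈ X ∨ (⟨v, hv⟩ : Fin n) ∈ Y := by
        by_contra h
        rw [not_or] at h
        exact hfree (by simp [free, h.1, h.2])
      refine ⟨fun _ => ⟨by omega, by split_ifs <;> omega, ?_, ?_⟩, fun h => ?_⟩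
      · rw [update_apply, if_neg (by simp), hq, hr]
      · refine hstep _ (if (⟨v, hv⟩ : Fin n) ∈ X then 1 else 0) (fun i => ?_) (by simp only [hmem])
        rw [update_apply]
        simp
      · rcases hfree' with h' | h' <;> simp [h'] at h
  · rintro τ hf ⟨-, h⟩
    exact hQ τ (hf0.trans hf) fun w => h w w.isLt

/-- Store the neighbours of the set in array `9` outside the set in array `8` in array `10`. -/
def neighbours : Program :=
  .seq (fill 10 (.lit 0)) <| forTo 23 (var 0 * var 0) <|
    .assign 10 (var 23 % var 0) <| .op .lt (.lit 0) <| .get 10 (var 23 % var 0) +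
      .get 9 (var 23 / var 0) * .get 1 (var 23) * .op .eq (.get 8 (var 23 % var 0)) (.lit 0)

theorem wp_neighbours (hB : n * n + n < B) (hG : HasGraph G σ) (hC : Ind σ 9 C) (hD : Ind σ 8 D)
    (hQ : ∀ τ, Frame [10, 22, 23] σ τ → Ind τ 10 (G.nbrs C D) → Q τ) :
    Wp B neighbours Q σ := by
  classical
  have h1B : 1 < 2 ^ B := Nat.one_lt_two_pow (by omega)
  rw [neighbours, wp_seq]
  refine wp_fill (S := (∅ : Finset (Fin n))) (by omega) hG.card (by decide) (by decide)
    (fun _ _ _ _ => by simp) ?_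
  intro τ₁ hf₁ hN₁
  have hf₁ : Frame [10, 22, 23] σ τ₁ := hf₁.mono (by decide)
  refine wp_forTo (N := n * n) [10, 22, 23] (fun j τ => Ind τ 10
    (Finset.univ.filter fun y : Fin n => y ∉ D ∧ ∃ x ∈ C, G.Adj x y ∧ x.val * n + y < j))
    (by simp) (by simp) (by omega) (by omega)
    ?_ ?_ ?_ ?_ ?_
  · intro τ hf
    rw [eval_mul, eval_var, (hf₁.trans hf) 0 (by decide), hG.card]
  · intro j τ v h
    exact h.update_of_ne (by decide) _ _
  · convert hN₁ using 1
    simp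
  · intro e he τ hf hv hN
    have hf' := hf₁.trans hf
    have hGτ : HasGraph G τ := hG.frame hf' (by decide) (by decide)
    have hCτ : Ind τ 9 C := hC.frame hf' (by decide)
    have hDτ : Ind τ 8 D := hD.frame hf' (by decide)
    obtain ⟨x, y, hxy, hx, hy⟩ := exists_edge he
    simp only [wp_assign, eval_mod, eval_div, eval_var, eval_lt, eval_get, eval_add, eval_mul,
      eval_eq, eval_lit, hGτ.card, hv, hx, hy]
    rw [hN y, hCτ x, hDτ y, hxy, hGτ.adj x y]
    refine ⟨by have := y.isLt; omega, by split_ifs <;> omega, hN.update y ?_ ?_⟩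
    · simp only [Finset.mem_filter, Finset.mem_univ, true_and]
      have hsucc : (∃ x' ∈ C, G.Adj x' y ∧ x'.val * n + y < x.val * n + y + 1) ↔
          (∃ x' ∈ C, G.Adj x' y ∧ x'.val * n + y < x.val * n + y) ∨ x ∈ C ∧ G.Adj x y := by
        constructor
        · rintro ⟨x', h1, h2, h3⟩
          rcases Nat.lt_succ_iff_lt_or_eq.1 h3 with h3 | h3
          · exact .inl ⟨x', h1, h2, h3⟩
          · obtain rfl := (edge_inj h3).1
            exact .inr ⟨h1, h2⟩
        · rintro (⟨x', h1, h2, h3⟩ | ⟨h1, h2⟩)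
          · exact ⟨x', h1, h2, by omega⟩
          · exact ⟨x, h1, h2, by omega⟩
      obtain ⟨p, hp⟩ : ∃ p : Prop, (∃ x' ∈ C, G.Adj x' y ∧ x'.val * n + y < x.val * n + y) ↔ p :=
        ⟨_, Iff.rfl⟩
      simp only [hsucc, hp]
      by_cases h1 : x ∈ C <;> by_cases h2 : G.Adj x y <;> by_cases h3 : y ∈ D <;>
        by_cases h4 : p <;> simp [h1, h2, h3, h4]
    · intro w hw
      simp only [Finset.mem_filter, Finset.mem_univ, true_and]
      refine and_congr_right fun _ => exists_congr fun x' => and_congr_right fun _ =>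
        and_congr_right fun _ => ⟨fun h => ?_, fun h => by omega⟩
      rcases Nat.lt_succ_iff_lt_or_eq.1 h with h | h
      · omega
      · exact absurd (edge_inj h).2 hw
  · intro τ hf hN
    refine hQ τ (hf₁.trans hf) ?_
    convert hN using 1
    ext y
    rw [mem_nbrs]
    simp only [Finset.mem_filter, Finset.mem_univ, true_and, edge_lt, and_true]

/-! ### The search as a program -/

/-- Reduce the number in cell `15[0]` by one third for each member of the set in array `10`. -/
def reduce : Program :=
  forTo 22 (var 0) <| .ite (.get 10 (var 22)) (put 15 (var 15 / .lit 3 * .lit 2)) .skip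

theorem wp_reduce (hB : n < B) (hG : HasGraph G σ) (hN : Ind σ 10 N) (hF : σ (15, 0) < 2 ^ B)
    (hQ : ∀ τ, Frame [15, 22] σ τ → τ (15, 0) = shrink (σ (15, 0)) N.card → Q τ) :
    Wp B reduce Q σ := by
  refine wp_forTo (N := n) [15, 22] (fun v τ => τ (15, 0) = shrink (σ (15, 0)) (rank N v))
    (by simp) (by simp) (by omega) (by omega) ?_ ?_ ?_ ?_ ?_
  · intro τ hf
    rw [eval_var, hf 0 (by decide), hG.card]
  · intro j τ v h
    rwa [update_apply, if_neg (by simp)]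
  · rw [rank_zero, shrink, Function.iterate_zero_apply]
  · intro v hv τ hf hcount hI
    have h10 : τ (10, v) = if (⟨v, hv⟩ : Fin n) ∈ N then 1 else 0 :=
      (hf 10 (by decide) v).trans (hN ⟨v, hv⟩)
    rw [wp_ite, wp_put, wp_skip]
    simp only [eval_get, eval_var, eval_div, eval_mul, eval_lit, hcount, h10, hI]
    by_cases h : (⟨v, hv⟩ : Fin n) ∈ N
    · have hr := rank_succ_of_mem h
      simp only at hr
      refine ⟨fun _ => ⟨by omega, ?_, ?_⟩, fun h' => absurd h' (by simp [h])⟩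
      · rw [← shrink_succ]
        exact (shrink_le _ _).trans_lt hF
      · rw [update_apply, if_pos rfl, hr, shrink_succ]
    · have hr := rank_succ_of_notMem h
      simp only at hr
      exact ⟨fun h' => absurd h' (by simp [h]), fun _ => by rw [hr]⟩
  · intro τ hf hI
    exact hQ τ hf (by rw [hI, rank_self])

/-- Add the set in array `10` to array `8`, and its member number `18[0]` to array `7`. -/
def select : Program :=
  .seq (put 19 (.lit 0)) <| forTo 22 (var 0) <| .ite (.get 10 (var 22))
    (.seq (.ite (.op .eq (var 19) (var 18)) (.assign 7 (var 22) (.lit 1)) .skip) <|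
      .seq (.assign 8 (var 22) (.lit 1)) (put 19 (var 19 + .lit 1)))
    .skip

theorem wp_select (hB : n < B) (hG : HasGraph G σ) (hK : Ind σ 7 K) (hD : Ind σ 8 D)
    (hN : Ind σ 10 N)
    (hQ : ∀ τ, Frame [7, 8, 19, 22] σ τ →
      Ind τ 7 (K ∪ N.filter fun v : Fin n => rank N v = σ (18, 0)) → Ind τ 8 (D ∪ N) → Q τ) :
    Wp B select Q σ := by
  have h1B : 1 < 2 ^ B := Nat.one_lt_two_pow (by omega)
  have hpow : B < 2 ^ B := Nat.lt_two_pow_self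
  rw [select, wp_seq, wp_put]
  refine ⟨by omega, by simp, ?_⟩
  have hf0 : Frame [7, 8, 19, 22] σ (σ.update (19, 0) ((Expr.lit 0).eval σ)) :=
    (Frame.refl _ σ).update (by decide) _ _
  refine wp_forTo (N := n) [7, 8, 19, 22] (fun j τ => τ (19, 0) = rank N j ∧
    Ind τ 7 (K ∪ N.filter fun v : Fin n => rank N v = σ (18, 0) ∧ v.val < j) ∧
    Ind τ 8 (D ∪ N.filter fun v : Fin n => v.val < j))
    (by simp) (by simp) (by omega) (by omega) ?_ ?_ ?_ ?_ ?_
  · intro τ hf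
    rw [eval_var, (hf0.trans hf) 0 (by decide), hG.card]
  · rintro j τ v ⟨h1, h2, h3⟩
    exact ⟨by rwa [update_apply, if_neg (by simp)], h2.update_of_ne (by decide) _ _,
      h3.update_of_ne (by decide) _ _⟩
  · refine ⟨by simp [update_apply, rank_zero], ?_, ?_⟩
    · simpa using hK.update_of_ne (k' := 19) (by decide) 0 0
    · simpa using hD.update_of_ne (k' := 19) (by decide) 0 0
  · rintro j hj τ hf hcount ⟨hr, hI7, hI8⟩
    set v : Fin n := ⟨j, hj⟩ with hv
    have hvj : v.val = j := rfl
    have hf' := hf0.trans hf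
    have h10 : τ (10, j) = if v ∈ N then 1 else 0 := (hf' 10 (by decide) j).trans (hN v)
    have hne : ∀ w : Fin n, w ≠ v → (w.val < j + 1 ↔ w.val < j) := fun w hw =>
      ⟨fun h => lt_of_le_of_ne (Nat.lt_succ_iff.1 h) fun e => hw (Fin.ext e), fun h => by omega⟩
    have hrank : rank N j ≤ n := by
      have := rank_mono (N := N) hj.le
      rw [rank_self] at this
      have h' := Finset.card_le_univ N
      rw [Fintype.card_fin] at h'
      omega
    simp only [wp_ite, wp_seq, wp_assign, wp_put, wp_skip, eval_get, eval_var, eval_eq, eval_add,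
      eval_lit, hcount, h10]
    by_cases h : v ∈ N
    swap
    · have hr' : rank N (j + 1) = rank N j := rank_succ_of_notMem h
      have hsame : ∀ p : Fin n → Prop, ∀ w ∈ N, (p w ∧ w.val < j + 1 ↔ p w ∧ w.val < j) :=
        fun p w hw => and_congr_right fun _ => hne w fun e => h (e ▸ hw)
      refine ⟨fun h' => absurd h' (by simp [h]), fun _ => ⟨by rw [hr, hr'], ?_, ?_⟩⟩
      · rwa [Finset.filter_congr (hsame fun w => rank N w = σ (18, 0))]
      · have := hsame fun _ => True
        simp only [true_and] at this
        rwa [Finset.filter_congr this]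
    have hr' : rank N (j + 1) = rank N j + 1 := rank_succ_of_mem h
    have h18 : τ (18, 0) = σ (18, 0) := hf' 18 (by decide) 0
    rw [if_pos h]
    refine ⟨fun _ => ⟨fun hsel => ?_, fun hsel => ?_⟩, fun h' => absurd h' (by simp)⟩
    · have hsel' : rank N v = σ (18, 0) := by
        rw [← h18, hvj, ← hr]
        by_contra hc
        simp [hc] at hsel
      refine ⟨by omega, h1B, ?_⟩
      simp only [update_apply, Prod.mk.injEq, Nat.reduceEqDiff, false_and,
        if_false, hcount, hr]
      refine ⟨by omega, h1B, by omega, by omega, ?_, ?_, ?_⟩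
      · simp [hr']
      · refine ((hI7.update v ?_ fun w hw => ?_).update_of_ne (by decide) _ _).update_of_ne
          (by decide) _ _
        · simp [h, ← hsel', hvj]
        · simp only [Finset.mem_union, Finset.mem_filter, hne w hw]
      · refine ((hI8.update_of_ne (by decide) _ _).update v ?_ fun w hw => ?_).update_of_ne
          (by decide) _ _
        · simp [h, hvj]
        · simp only [Finset.mem_union, Finset.mem_filter, hne w hw]
    · have hsel' : rank N v ≠ σ (18, 0) := by
        rw [← h18, hvj, ← hr]
        intro hc
        simp [hc] at hsel
      refine ⟨by omega, h1B, ?_⟩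
      simp only [update_apply, Prod.mk.injEq, Nat.reduceEqDiff, false_and,
        if_false, hr]
      refine ⟨by omega, by omega, ?_, ?_, ?_⟩
      · simp [hr']
      · refine (Ind.update_of_ne ?_ (by decide) _ _).update_of_ne (by decide) _ _
        intro w
        rw [hI7 w]
        by_cases hw : w = v
        · subst hw
          simp [hsel']
        · simp only [Finset.mem_union, Finset.mem_filter, hne w hw]
      · refine (hI8.update v ?_ fun w hw => ?_).update_of_ne (by decide) _ _
        · simp [h, hvj]
        · simp only [Finset.mem_union, Finset.mem_filter, hne w hw]
  · rintro τ hf ⟨-, h7, h8⟩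
    refine hQ τ (hf0.trans hf) ?_ ?_
    · simpa using h7
    · simpa using h8

/-- The memory holds the state `s` of the search. -/
structure HasState (s : State n) (σ : Store) : Prop where
  K : Ind σ 7 s.K
  D : Ind σ 8 s.D
  r : σ (17, 0) = s.r
  I : σ (16, 0) = s.I
  F : σ (15, 0) = s.F

theorem HasState.frame {s : State n} (h : HasState s σ) (hf : Frame W σ τ) (h7 : 7 ∉ W)
    (h8 : 8 ∉ W) (h15 : 15 ∉ W) (h16 : 16 ∉ W) (h17 : 17 ∉ W) : HasState s τ :=
  ⟨h.K.frame hf h7, h.D.frame hf h8, by rw [hf 17 h17, h.r], by rw [hf 16 h16, h.I],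
    by rw [hf 15 h15, h.F]⟩

/-- One step of the search. -/
def step : Program :=
  .ite (.op .lt (var 17) (var 0))
    (.ite (.get 5 (var 17))
      (.seq (component 7 (var 17)) <| .seq neighbours <|
        .ite (.op .lt (var 16) (var 15 / .lit 9))
          (.seq (put 15 (var 15 / .lit 9)) (put 17 (var 17 + .lit 1)))
          (.seq (put 16 (var 16 - var 15 / .lit 9)) <| .seq reduce <|
            .seq (put 18 (var 16 / var 15)) <| .seq (put 16 (var 16 % var 15)) select))
      (put 17 (var 17 + .lit 1)))
    .skip

theorem wp_step {s : State n} (hB : n * n + n + 1 < B) (hG : HasGraph G σ) (hX : Ind σ 5 X)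
    (hs : HasState s σ) (hI : s.I < 2 ^ B) (hF : s.F < 2 ^ B)
    (hQ : ∀ τ, Frame [7, 8, 9, 10, 15, 16, 17, 18, 19, 22, 23] σ τ →
      HasState (G.grow X s) τ → Q τ) : Wp B step Q σ := by
  have hpow : B < 2 ^ B := Nat.lt_two_pow_self
  rw [step, wp_ite, wp_ite]
  simp only [eval_lt, eval_var, eval_get, hs.r, hG.card]
  by_cases hr : s.r < n
  swap
  · refine ⟨fun h => absurd h (by simp [hr]), fun _ => ?_⟩
    rw [wp_skip]
    refine hQ σ (Frame.refl _ σ) ?_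
    simpa only [grow, hr, if_false] using hs
  refine ⟨fun _ => ?_, fun h => absurd h (by simp [hr])⟩
  have h5 : σ (5, s.r) = if (⟨s.r, hr⟩ : Fin n) ∈ X then 1 else 0 := hX ⟨s.r, hr⟩
  have hex : (∃ v ∈ X, v.val = s.r) ↔ (⟨s.r, hr⟩ : Fin n) ∈ X :=
    ⟨fun ⟨v, hv, e⟩ => by rwa [show v = ⟨s.r, hr⟩ from Fin.ext e] at hv, fun h => ⟨_, h, rfl⟩⟩
  by_cases hrX : (⟨s.r, hr⟩ : Fin n) ∈ X
  swap
  · refine ⟨fun h => absurd h (by simp [h5, hrX]), fun _ => ?_⟩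
    rw [wp_put, eval_add, eval_var, eval_lit, hs.r]
    refine ⟨by omega, by omega, hQ _ ((Frame.refl _ σ).update (by decide) _ _) ?_⟩
    simp only [grow, hr, if_true, hex, hrX, if_false]
    refine ⟨hs.K.update_of_ne (by decide) _ _, hs.D.update_of_ne (by decide) _ _, ?_, ?_, ?_⟩
    · simp [update_apply]
    · simp [update_apply, hs.I]
    · simp [update_apply, hs.F]
  refine ⟨fun _ => ?_, fun h => absurd h (by simp [h5, hrX])⟩
  rw [wp_seq]
  refine wp_component (by decide) (by decide) (by omega) hG hs.K ?_
  intro τ₁ hf₁ hC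
  rw [hs.r] at hC
  have hs₁ := hs.frame hf₁ (by decide) (by decide) (by decide) (by decide) (by decide)
  rw [wp_seq]
  refine wp_neighbours (by omega) (hG.frame hf₁ (by decide) (by decide)) hC hs₁.D ?_
  intro τ₂ hf₂ hN
  have hs₂ := hs₁.frame hf₂ (by decide) (by decide) (by decide) (by decide) (by decide)
  have hf₂' : Frame [7, 8, 9, 10, 15, 16, 17, 18, 19, 22, 23] σ τ₂ :=
    (hf₁.mono (by decide)).trans (hf₂.mono (by decide))
  have hG₂ : HasGraph G τ₂ := hG.frame hf₂' (by decide) (by decide)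
  have h9 : s.F / 9 ≤ s.F := Nat.div_le_self _ _
  have hgrow : G.grow X s = if s.I < s.F / 9 then { s with F := s.F / 9, r := s.r + 1 }
      else
        { K := s.K ∪ (G.nbrs (G.comp s.K s.r) s.D).filter fun v : Fin n =>
            rank (G.nbrs (G.comp s.K s.r) s.D) v = (s.I - s.F / 9) /
              shrink s.F (G.nbrs (G.comp s.K s.r) s.D).card
          D := s.D ∪ G.nbrs (G.comp s.K s.r) s.D
          r := s.r
          I := (s.I - s.F / 9) % shrink s.F (G.nbrs (G.comp s.K s.r) s.D).card
          F := shrink s.F (G.nbrs (G.comp s.K s.r) s.D).card } := by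
    unfold grow
    rw [if_pos hr, if_pos (hex.2 hrX)]
  rw [hgrow] at hQ
  generalize G.nbrs (G.comp s.K s.r) s.D = N at hN hQ
  clear hgrow
  rw [wp_ite]
  simp only [eval_lt, eval_var, eval_div, eval_lit, hs₂.I, hs₂.F]
  by_cases hlt : s.I < s.F / 9
  · refine ⟨fun _ => ?_, fun h => absurd h (by simp [hlt])⟩
    simp only [if_pos hlt] at hQ
    rw [wp_seq, wp_put, eval_div, eval_var, eval_lit, hs₂.F]
    refine ⟨by omega, by omega, ?_⟩
    rw [wp_put, eval_add, eval_var, eval_lit, update_apply, if_neg (by simp), hs₂.r]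
    refine ⟨by omega, by omega,
      hQ _ ((hf₂'.update (by decide) _ _).update (by decide) _ _) ?_⟩
    refine ⟨(hs₂.K.update_of_ne (by decide) _ _).update_of_ne (by decide) _ _,
      (hs₂.D.update_of_ne (by decide) _ _).update_of_ne (by decide) _ _, ?_, ?_, ?_⟩
    · simp [update_apply]
    · simp [update_apply, hs₂.I]
    · simp [update_apply]
  · refine ⟨fun h => absurd h (by simp [hlt]), fun _ => ?_⟩
    simp only [if_neg hlt] at hQ
    rw [wp_seq, wp_put]
    simp only [eval_sub, eval_var, eval_div, eval_lit, hs₂.I, hs₂.F]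
    refine ⟨by omega, by omega, ?_⟩
    have hf₃ : Frame [16] τ₂ (τ₂.update (16, 0) (s.I - s.F / 9)) :=
      (Frame.refl _ τ₂).update (by decide) _ _
    have hI₃ : τ₂.update (16, 0) (s.I - s.F / 9) (16, 0) = s.I - s.F / 9 := by simp [update_apply]
    generalize τ₂.update (16, 0) (s.I - s.F / 9) = τ₃ at hf₃ hI₃
    have hF₃ : τ₃ (15, 0) = s.F := by rw [hf₃ 15 (by decide), hs₂.F]
    rw [wp_seq]
    refine wp_reduce (by omega) (hG₂.frame hf₃ (by decide) (by decide))
      (hN.frame hf₃ (by decide)) (by rwa [hF₃]) ?_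
    intro τ₄ hf₄ hF₄
    rw [hF₃] at hF₄
    have hI₄ : τ₄ (16, 0) = s.I - s.F / 9 := by rw [hf₄ 16 (by decide), hI₃]
    have hf₄' : Frame [7, 8, 9, 10, 15, 16, 17, 18, 19, 22, 23] σ τ₄ :=
      (hf₂'.trans (hf₃.mono (by decide))).trans (hf₄.mono (by decide))
    have hf₂₄ : Frame [15, 16, 22] τ₂ τ₄ := (hf₃.mono (by decide)).trans (hf₄.mono (by decide))
    rw [wp_seq, wp_put, eval_div, eval_var, eval_var, hF₄, hI₄]
    refine ⟨by omega, (Nat.div_le_self _ _).trans_lt (by omega), ?_⟩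
    rw [wp_seq, wp_put]
    simp only [eval_mod, eval_var, update_apply, Prod.mk.injEq,
      Nat.reduceEqDiff, false_and, if_false, hF₄, hI₄]
    refine ⟨by omega, (Nat.mod_le _ _).trans_lt (by omega), ?_⟩
    generalize hF' : shrink s.F N.card = F' at hQ hF₄
    have hf₅ : Frame [16, 18] τ₄ ((τ₄.update (18, 0) ((s.I - s.F / 9) / F')).update (16, 0)
        ((s.I - s.F / 9) % F')) :=
      ((Frame.refl _ τ₄).update (by decide) _ _).update (by decide) _ _
    have h16 : ((τ₄.update (18, 0) ((s.I - s.F / 9) / F')).update (16, 0)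
        ((s.I - s.F / 9) % F')) (16, 0) = (s.I - s.F / 9) % F' := by simp [update_apply]
    have h18 : ((τ₄.update (18, 0) ((s.I - s.F / 9) / F')).update (16, 0)
        ((s.I - s.F / 9) % F')) (18, 0) = (s.I - s.F / 9) / F' := by simp [update_apply]
    generalize (τ₄.update (18, 0) ((s.I - s.F / 9) / F')).update (16, 0)
      ((s.I - s.F / 9) % F') = τ₅ at hf₅ h16 h18
    have hf₂₅ : Frame [15, 16, 18, 22] τ₂ τ₅ :=
      (hf₂₄.mono (by decide)).trans (hf₅.mono (by decide))
    have hf₅' : Frame [7, 8, 9, 10, 15, 16, 17, 18, 19, 22, 23] σ τ₅ :=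
      hf₄'.trans (hf₅.mono (by decide))
    refine wp_select (by omega) (hG₂.frame hf₂₅ (by decide) (by decide))
      (hs₂.K.frame hf₂₅ (by decide)) (hs₂.D.frame hf₂₅ (by decide)) (hN.frame hf₂₅ (by decide)) ?_
    intro τ₆ hf₆ h7 h8
    rw [h18] at h7
    refine hQ τ₆ (hf₅'.trans (hf₆.mono (by decide))) ⟨h7, h8, ?_, ?_, ?_⟩
    · rw [hf₆ 17 (by decide), hf₂₅ 17 (by decide), hs₂.r]
    · rw [hf₆ 16 (by decide), h16]
    · rw [hf₆ 15 (by decide), hf₅ 15 (by decide), hF₄]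

theorem grow_le (X : Finset (Fin n)) (s : State n) :
    (G.grow X s).I ≤ s.I ∧ (G.grow X s).F ≤ s.F := by
  unfold grow
  split_ifs
  · exact ⟨le_rfl, Nat.div_le_self _ _⟩
  · exact ⟨(Nat.mod_le _ _).trans (Nat.sub_le _ _), shrink_le _ _⟩
  all_goals exact ⟨le_rfl, le_rfl⟩

/-- Decode the product of the numbers in the cells `14[0]` and `12[0]` into a vertex set in array
`7` by the search for a connecting set, with the initial interval length in cell `13[0]`. -/
def search : Program :=
  .seq (put 16 (var 14 * var 12)) <| .seq (put 15 (var 13)) <| .seq (put 17 (.lit 0)) <|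
    .seq (fill 7 (.get 5 (var 22))) <|
    .seq (fill 8 (.op .lt (.lit 0) (.get 5 (var 22) + .get 6 (var 22)))) <|
    forTo 24 (.lit 2 * var 0) step

theorem wp_search (hB : n * n + 2 * n + 1 < B) (hG : HasGraph G σ) (hX : Ind σ 5 X) (hY : Ind σ 6 Y)
    (hI : σ (14, 0) * σ (12, 0) < 2 ^ B)
    (hF : σ (13, 0) = 9 ^ X.card * 3 ^ (free X Y).card) (hF' : σ (13, 0) < 2 ^ B)
    (hQ : ∀ τ, Frame [7, 8, 9, 10, 15, 16, 17, 18, 19, 22, 23, 24] σ τ →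
      Ind τ 7 (G.grown X Y (σ (14, 0) * σ (12, 0))) → Q τ) : Wp B search Q σ := by
  rw [search, wp_seq, wp_put, eval_mul, eval_var, eval_var]
  refine ⟨by omega, hI, ?_⟩
  rw [wp_seq, wp_put, eval_var, update_apply, if_neg (by simp)]
  refine ⟨by omega, hF', ?_⟩
  rw [wp_seq, wp_put, eval_lit]
  refine ⟨by omega, by simp, ?_⟩
  have hf₁ : Frame [15, 16, 17] σ (((σ.update (16, 0) (σ (14, 0) * σ (12, 0))).update (15, 0)
      (σ (13, 0))).update (17, 0) 0) :=
    (((Frame.refl _ σ).update (by decide) _ _).update (by decide) _ _).update (by decide) _ _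
  have h15 : ((σ.update (16, 0) (σ (14, 0) * σ (12, 0))).update (15, 0)
      (σ (13, 0))).update (17, 0) 0 (15, 0) = σ (13, 0) := by simp [update_apply]
  have h16 : ((σ.update (16, 0) (σ (14, 0) * σ (12, 0))).update (15, 0)
      (σ (13, 0))).update (17, 0) 0 (16, 0) = σ (14, 0) * σ (12, 0) := by simp [update_apply]
  have h17 : ((σ.update (16, 0) (σ (14, 0) * σ (12, 0))).update (15, 0)
      (σ (13, 0))).update (17, 0) 0 (17, 0) = 0 := by simp [update_apply]
  generalize ((σ.update (16, 0) (σ (14, 0) * σ (12, 0))).update (15, 0)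
      (σ (13, 0))).update (17, 0) 0 = τ₁ at hf₁ h15 h16 h17
  have hG₁ : HasGraph G τ₁ := hG.frame hf₁ (by decide) (by decide)
  have hX₁ : Ind τ₁ 5 X := hX.frame hf₁ (by decide)
  have hY₁ : Ind τ₁ 6 Y := hY.frame hf₁ (by decide)
  rw [wp_seq]
  refine wp_fill (S := X) (by omega) hG₁.card (by decide) (by decide)
    (fun v τ hf hv => by rw [eval_get, eval_var, hv, hf 5 (by decide), hX₁ v]) ?_
  intro τ₂ hf₂ h7
  have hG₂ : HasGraph G τ₂ := hG₁.frame hf₂ (by decide) (by decide)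
  have hX₂ : Ind τ₂ 5 X := hX₁.frame hf₂ (by decide)
  have hY₂ : Ind τ₂ 6 Y := hY₁.frame hf₂ (by decide)
  rw [wp_seq]
  refine wp_fill (S := X ∪ Y) (by omega) hG₂.card (by decide) (by decide) (fun v τ hf hv => ?_) ?_
  · rw [eval_lt, eval_add, eval_get, eval_get, eval_var, eval_lit, hv, hf 5 (by decide),
      hf 6 (by decide), hX₂ v, hY₂ v]
    by_cases h1 : v ∈ X <;> by_cases h2 : v ∈ Y <;> simp [h1, h2]
  intro τ₃ hf₃ h8
  have hs₃ : HasState (start X Y (σ (14, 0) * σ (12, 0))) τ₃ := by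
    refine ⟨h7.frame hf₃ (by decide), h8, ?_, ?_, ?_⟩
    · rw [hf₃ 17 (by decide), hf₂ 17 (by decide), h17, start]
    · rw [hf₃ 16 (by decide), hf₂ 16 (by decide), h16, start]
    · rw [hf₃ 15 (by decide), hf₂ 15 (by decide), h15, hF, start]
  have hf₃' : Frame [7, 8, 9, 10, 15, 16, 17, 18, 19, 22, 23, 24] σ τ₃ :=
    ((hf₁.mono (by decide)).trans (hf₂.mono (by decide))).trans (hf₃.mono (by decide))
  refine wp_forTo (N := 2 * n) [7, 8, 9, 10, 15, 16, 17, 18, 19, 22, 23, 24]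
    (fun j τ => HasState ((G.grow X)^[j] (start X Y (σ (14, 0) * σ (12, 0)))) τ)
    (by decide) (by decide) (by omega) (by omega) ?_ ?_ hs₃ ?_ ?_
  · intro τ hf
    rw [eval_mul, eval_lit, eval_var, (hf₃'.trans hf) 0 (by decide), hG.card]
  · intro j τ v h
    exact h.frame ((Frame.refl [24] τ).update (by decide) _ _) (by decide) (by decide) (by decide)
      (by decide) (by decide)
  · intro j hj τ hf hcount hs
    have hf' := hf₃'.trans hf
    have hle : ∀ j, ((G.grow X)^[j] (start X Y (σ (14, 0) * σ (12, 0)))).I < 2 ^ B ∧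
        ((G.grow X)^[j] (start X Y (σ (14, 0) * σ (12, 0)))).F < 2 ^ B := by
      intro j
      induction j with
      | zero => exact ⟨hI, by rw [Function.iterate_zero_apply, start, ← hF]; exact hF'⟩
      | succ j ih =>
        rw [Function.iterate_succ_apply']
        have := grow_le (G := G) X ((G.grow X)^[j] (start X Y (σ (14, 0) * σ (12, 0))))
        omega
    refine wp_step (by omega) (hG.frame hf' (by decide) (by decide)) (hX.frame hf' (by decide)) hs
      (hle j).1 (hle j).2 ?_
    intro τ' _ hs'
    rwa [Function.iterate_succ_apply']
  · intro τ hf hs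
    exact hQ τ (hf₃'.trans hf) hs.K

/-! ### Preparations -/

/-- Copy the smaller of the sets in the arrays `2` and `3` to array `5`, the larger to array `6`. -/
def order : Program :=
  .seq (put 25 (.lit 0)) <| .seq (put 26 (.lit 0)) <|
    .seq (forTo 22 (var 0) <|
      .seq (put 25 (var 25 + .get 2 (var 22))) (put 26 (var 26 + .get 3 (var 22)))) <|
    .seq (put 27 (.op .lt (var 26) (var 25))) <|
    .seq (fill 5 (var 27 * .get 3 (var 22) + (.lit 1 - var 27) * .get 2 (var 22)))
      (fill 6 (var 27 * .get 2 (var 22) + (.lit 1 - var 27) * .get 3 (var 22)))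

theorem rank_succ (X : Finset (Fin n)) (v : Fin n) :
    rank X (v + 1) = rank X v + if v ∈ X then 1 else 0 := by
  by_cases h : v ∈ X
  · rw [rank_succ_of_mem h, if_pos h]
  · rw [rank_succ_of_notMem h, if_neg h, add_zero]

theorem rank_le (X : Finset (Fin n)) {v : ℕ} (hv : v ≤ n) : rank X v ≤ n := by
  have h := rank_mono (N := X) hv
  have h' := Finset.card_le_univ X
  rw [Fintype.card_fin] at h'
  rw [rank_self] at h
  omega

theorem wp_order {Z₁ Z₂ : Finset (Fin n)} (hB : n + 1 < B) (hG : HasGraph G σ) (h₁ : Ind σ 2 Z₁)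
    (h₂ : Ind σ 3 Z₂)
    (hQ : ∀ τ X Y, Frame [5, 6, 22, 25, 26, 27] σ τ → Ind τ 5 X → Ind τ 6 Y → X.card ≤ Y.card →
      (X = Z₁ ∧ Y = Z₂ ∨ X = Z₂ ∧ Y = Z₁) → Q τ) : Wp B order Q σ := by
  have hpow : B < 2 ^ B := Nat.lt_two_pow_self
  rw [order, wp_seq, wp_put, eval_lit]
  refine ⟨by omega, by omega, ?_⟩
  rw [wp_seq, wp_put, eval_lit]
  refine ⟨by omega, by omega, ?_⟩
  have hf₁ : Frame [5, 6, 22, 25, 26, 27] σ ((σ.update (25, 0) 0).update (26, 0) 0) :=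
    ((Frame.refl _ σ).update (by decide) _ _).update (by decide) _ _
  have h25 : (σ.update (25, 0) 0).update (26, 0) 0 (25, 0) = 0 := by simp [update_apply]
  have h26 : (σ.update (25, 0) 0).update (26, 0) 0 (26, 0) = 0 := by simp [update_apply]
  generalize (σ.update (25, 0) 0).update (26, 0) 0 = τ₁ at hf₁ h25 h26
  rw [wp_seq]
  refine wp_forTo (N := n) [5, 6, 22, 25, 26, 27]
    (fun j τ => τ (25, 0) = rank Z₁ j ∧ τ (26, 0) = rank Z₂ j)
    (by decide) (by decide) (by omega) (by omega) ?_ ?_ ?_ ?_ ?_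
  · intro τ hf
    rw [eval_var, (hf₁.trans hf) 0 (by decide), hG.card]
  · rintro j τ v ⟨h, h'⟩
    exact ⟨by rwa [update_apply, if_neg (by simp)], by rwa [update_apply, if_neg (by simp)]⟩
  · exact ⟨by rw [h25, rank_zero], by rw [h26, rank_zero]⟩
  · rintro j hj τ hf hcount ⟨hr₁, hr₂⟩
    have hf' := hf₁.trans hf
    have hz₁ : τ (2, j) = if (⟨j, hj⟩ : Fin n) ∈ Z₁ then 1 else 0 :=
      (hf' 2 (by decide) j).trans (h₁ ⟨j, hj⟩)
    have hz₂ : τ (3, j) = if (⟨j, hj⟩ : Fin n) ∈ Z₂ then 1 else 0 :=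
      (hf' 3 (by decide) j).trans (h₂ ⟨j, hj⟩)
    have hs₁ := rank_succ Z₁ ⟨j, hj⟩
    have hs₂ := rank_succ Z₂ ⟨j, hj⟩
    simp only at hs₁ hs₂
    rw [← hz₁, ← hr₁] at hs₁
    rw [← hz₂, ← hr₂] at hs₂
    have hl₁ := rank_le Z₁ (v := j + 1) hj
    have hl₂ := rank_le Z₂ (v := j + 1) hj
    simp only [wp_seq, wp_put, eval_add, eval_var, eval_get, update_apply, Prod.mk.injEq,
      Nat.reduceEqDiff, false_and, if_false, if_true, hcount]
    exact ⟨by omega, by omega, by omega, by omega, hs₁.symm, hs₂.symm⟩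
  rintro τ₂ hf₂ ⟨hr₁, hr₂⟩
  rw [rank_self] at hr₁ hr₂
  have hf₂' := hf₁.trans hf₂
  rw [wp_seq, wp_put, eval_lt, eval_var, eval_var, hr₁, hr₂]
  refine ⟨by omega, by split_ifs <;> omega, ?_⟩
  have hf₃ := hf₂'.update (k := 27) (by decide) 0 (if Z₂.card < Z₁.card then 1 else 0)
  have h27 : τ₂.update (27, 0) (if Z₂.card < Z₁.card then 1 else 0) (27, 0) =
    if Z₂.card < Z₁.card then 1 else 0 := by simp [update_apply]
  generalize τ₂.update (27, 0) (if Z₂.card < Z₁.card then 1 else 0) = τ₃ at hf₃ h27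
  have hG₃ : HasGraph G τ₃ := hG.frame hf₃ (by decide) (by decide)
  have h₁' : Ind τ₃ 2 Z₁ := h₁.frame hf₃ (by decide)
  have h₂' : Ind τ₃ 3 Z₂ := h₂.frame hf₃ (by decide)
  rw [wp_seq]
  refine wp_fill (S := if Z₂.card < Z₁.card then Z₂ else Z₁) (by omega) hG₃.card (by decide)
    (by decide) ?_ ?_
  · intro v τ hf hv
    simp only [eval_add, eval_mul, eval_sub, eval_lit, eval_var, eval_get, hv,
      hf 27 (by decide), hf 3 (by decide), hf 2 (by decide), h27, h₁' v, h₂' v]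
    split_ifs <;> simp_all
  intro τ₄ hf₄ hX
  have hf₄' : Frame [5, 6, 22, 25, 26, 27] σ τ₄ := hf₃.trans (hf₄.mono (by decide))
  refine wp_fill (S := if Z₂.card < Z₁.card then Z₁ else Z₂) (by omega)
    (hG₃.frame hf₄ (by decide) (by decide)).card (by decide) (by decide) ?_ ?_
  · intro v τ hf hv
    have hf' := (hf₄.mono (W' := [22, 5, 6]) (by decide)).trans (hf.mono (by decide))
    simp only [eval_add, eval_mul, eval_sub, eval_lit, eval_var, eval_get, hv,
      hf' 27 (by decide), hf' 3 (by decide), hf' 2 (by decide), h27, h₁' v, h₂' v]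
    split_ifs <;> simp_all
  intro τ₅ hf₅ hY
  refine hQ τ₅ _ _ (hf₄'.trans (hf₅.mono (by decide))) (hX.frame hf₅ (by decide)) hY ?_ ?_
  · split_ifs <;> omega
  · split_ifs
    · exact .inr ⟨rfl, rfl⟩
    · exact .inl ⟨rfl, rfl⟩

/-- Compute the number of sets to try by brute force and the initial interval length of the
search. -/
def measure : Program :=
  .seq (put 12 (.lit 1)) <| .seq (put 13 (.lit 1)) <| forTo 22 (var 0) <|
    .ite (.get 5 (var 22)) (put 13 (var 13 * .lit 9)) <|
    .ite (.get 6 (var 22)) .skip (.seq (put 12 (var 12 * .lit 2)) (put 13 (var 13 * .lit 3)))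

theorem two_pow_rank_lt (hB : 5 * n < B) (X Y : Finset (Fin n)) {v : ℕ} (hv : v ≤ n) :
    2 ^ rank (free X Y) v < 2 ^ B ∧ 9 ^ rank X v * 3 ^ rank (free X Y) v < 2 ^ B := by
  have h1 := rank_le X hv
  have h2 := rank_le (free X Y) hv
  constructor
  · exact Nat.pow_lt_pow_right (by norm_num) (by omega)
  · calc 9 ^ rank X v * 3 ^ rank (free X Y) v ≤ 9 ^ n * 3 ^ n := Nat.mul_le_mul
          (Nat.pow_le_pow_right (by norm_num) h1) (Nat.pow_le_pow_right (by norm_num) h2)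
      _ = 27 ^ n := by rw [← mul_pow]; norm_num
      _ ≤ (2 ^ 5) ^ n := Nat.pow_le_pow_left (by norm_num) n
      _ = 2 ^ (5 * n) := by rw [pow_mul]
      _ < 2 ^ B := Nat.pow_lt_pow_right (by norm_num) hB

theorem wp_measure (hB : 5 * n + 1 < B) (hG : HasGraph G σ) (hX : Ind σ 5 X) (hY : Ind σ 6 Y)
    (hQ : ∀ τ, Frame [12, 13, 22] σ τ → τ (12, 0) = 2 ^ (free X Y).card →
      τ (13, 0) = 9 ^ X.card * 3 ^ (free X Y).card → Q τ) : Wp B measure Q σ := by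
  have h1B : 1 < 2 ^ B := Nat.one_lt_two_pow (by omega)
  rw [measure, wp_seq, wp_put, eval_lit]
  refine ⟨by omega, h1B, ?_⟩
  rw [wp_seq, wp_put, eval_lit]
  refine ⟨by omega, h1B, ?_⟩
  have hf₁ : Frame [12, 13, 22] σ ((σ.update (12, 0) 1).update (13, 0) 1) :=
    ((Frame.refl _ σ).update (by decide) _ _).update (by decide) _ _
  have h12 : (σ.update (12, 0) 1).update (13, 0) 1 (12, 0) = 1 := by simp [update_apply]
  have h13 : (σ.update (12, 0) 1).update (13, 0) 1 (13, 0) = 1 := by simp [update_apply]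
  generalize (σ.update (12, 0) 1).update (13, 0) 1 = τ₁ at hf₁ h12 h13
  refine wp_forTo (N := n) [12, 13, 22] (fun j τ => τ (12, 0) = 2 ^ rank (free X Y) j ∧
    τ (13, 0) = 9 ^ rank X j * 3 ^ rank (free X Y) j)
    (by decide) (by decide) (by omega) (by omega) ?_ ?_ ?_ ?_ ?_
  · intro τ hf
    rw [eval_var, (hf₁.trans hf) 0 (by decide), hG.card]
  · rintro j τ v ⟨h, h'⟩
    exact ⟨by rwa [update_apply, if_neg (by simp)], by rwa [update_apply, if_neg (by simp)]⟩
  · simp [h12, h13, rank_zero]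
  · rintro j hj τ hf hcount ⟨hI, hI'⟩
    have hf' := hf₁.trans hf
    have h5 : τ (5, j) = if (⟨j, hj⟩ : Fin n) ∈ X then 1 else 0 :=
      (hf' 5 (by decide) j).trans (hX ⟨j, hj⟩)
    have h6 : τ (6, j) = if (⟨j, hj⟩ : Fin n) ∈ Y then 1 else 0 :=
      (hf' 6 (by decide) j).trans (hY ⟨j, hj⟩)
    have hs := rank_succ X ⟨j, hj⟩
    have hs' := rank_succ (free X Y) ⟨j, hj⟩
    have hlt := two_pow_rank_lt (B := B) (by omega) X Y (v := j + 1) hj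
    have hfree : (⟨j, hj⟩ : Fin n) ∈ free X Y ↔
        (⟨j, hj⟩ : Fin n) ∉ X ∧ (⟨j, hj⟩ : Fin n) ∉ Y := by simp [free]
    simp only [hfree] at hs hs'
    simp only [wp_ite, wp_seq, wp_put, wp_skip, eval_mul, eval_var, eval_get, eval_lit,
      update_apply, Prod.mk.injEq, Nat.reduceEqDiff, false_and, if_false, if_true, hcount,
      h5, h6, hI, hI']
    rw [hs, hs'] at hlt ⊢
    by_cases hjX : (⟨j, hj⟩ : Fin n) ∈ X
    · have e : 9 ^ (rank X j + 1) * 3 ^ rank (free X Y) j =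
          9 ^ rank X j * 3 ^ rank (free X Y) j * 9 := by ring
      simp only [hjX, not_true_eq_false, false_and, if_false, if_true, add_zero] at hlt ⊢
      rw [e] at hlt ⊢
      exact ⟨fun _ => ⟨by omega, hlt.2, by simp⟩, fun h => absurd h one_ne_zero⟩
    by_cases hjY : (⟨j, hj⟩ : Fin n) ∈ Y
    · simp [hjX, hjY]
    · have e : 9 ^ rank X j * 3 ^ (rank (free X Y) j + 1) =
          9 ^ rank X j * 3 ^ rank (free X Y) j * 3 := by ring
      simp only [hjX, hjY, not_false_eq_true, and_true, if_false, if_true, add_zero] at hlt ⊢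
      rw [e, pow_succ 2] at hlt ⊢
      exact ⟨fun h => absurd rfl h, fun _ => ⟨fun h => absurd rfl h,
        fun _ => ⟨by omega, hlt.1, by omega, hlt.2, rfl, rfl⟩⟩⟩
  · rintro τ hf ⟨h, h'⟩
    rw [rank_self] at h
    rw [rank_self, rank_self] at h'
    exact hQ τ (hf₁.trans hf) h h'

/-! ### The main loop -/

/-- The preparations for the main loop. -/
def prepare : Program :=
  .seq order <| .seq measure <| .seq (put 4 (.lit 0)) (put 14 (.lit 0))

/-- Try the two sets that belong to the number in cell `14[0]`, and increase this number. -/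
def round : Program :=
  .seq decode <| .seq test <| .seq search <| .seq test (put 14 (var 14 + .lit 1))

/-- The number in cell `14[0]` is below both bounds. -/
def bounds : Expr := .op .lt (var 14) (var 12) * .op .lt (var 14 * var 12) (var 13)

/-- The program: the numbers `j = 0, 1, …` are decoded both bit by bit and by the search for a
connecting set, until one of the two methods has run through all its candidates. -/
def solve : Program :=
  .seq prepare (.loop bounds round)

/-- One of the two sets that belong to `j` solves the problem. -/
def Hit (G : SimpleGraph (Fin n)) (X Y : Finset (Fin n)) (j : ℕ) : Prop :=
  Solves G X Y (bitSet X Y j) ∨ Solves G X Y (G.grown X Y (j * 2 ^ (free X Y).card))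

/-- Both methods have candidates left. -/
def Open (X Y : Finset (Fin n)) (j : ℕ) : Prop :=
  j < 2 ^ (free X Y).card ∧ j * 2 ^ (free X Y).card < 9 ^ X.card * 3 ^ (free X Y).card

open scoped Classical in
/-- The invariant of the main loop. -/
structure Invariant (G : SimpleGraph (Fin n)) (X Y : Finset (Fin n)) (j : ℕ) (σ : Store) :
    Prop where
  graph : HasGraph G σ
  fst : Ind σ 5 X
  snd : Ind σ 6 Y
  sets : σ (12, 0) = 2 ^ (free X Y).card
  length : σ (13, 0) = 9 ^ X.card * 3 ^ (free X Y).card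
  index : σ (14, 0) = j
  answer : σ (4, 0) = if ∃ i < j, Hit G X Y i then 1 else 0

theorem eval_bounds {j : ℕ} (h : Invariant G X Y j σ) : bounds.eval σ ≠ 0 ↔ Open X Y j := by
  simp only [bounds, Open, eval_mul, eval_lt, eval_var, h.sets, h.length, h.index]
  split_ifs <;> simp_all

theorem wp_prepare {Z₁ Z₂ : Finset (Fin n)} (hB : 5 * n + 1 < B) (hG : HasGraph G σ)
    (h₁ : Ind σ 2 Z₁) (h₂ : Ind σ 3 Z₂) :
    Wp B prepare (fun τ => ∃ X Y, Invariant G X Y 0 τ ∧ X.card ≤ Y.card ∧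
      (X = Z₁ ∧ Y = Z₂ ∨ X = Z₂ ∧ Y = Z₁)) σ := by
  rw [prepare, wp_seq]
  refine wp_order (by omega) hG h₁ h₂ ?_
  intro τ₁ X Y hf₁ hX hY hle hXY
  have hG₁ : HasGraph G τ₁ := hG.frame hf₁ (by decide) (by decide)
  rw [wp_seq]
  refine wp_measure (by omega) hG₁ hX hY ?_
  intro τ₂ hf₂ h12 h13
  rw [wp_seq, wp_put, wp_put, eval_lit, eval_lit]
  have hf₃ : Frame [4, 14] τ₂ ((τ₂.update (4, 0) 0).update (14, 0) 0) :=
    ((Frame.refl _ τ₂).update (by decide) _ _).update (by decide) _ _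
  have hf₃' : Frame [4, 12, 13, 14, 22] τ₁ ((τ₂.update (4, 0) 0).update (14, 0) 0) :=
    (hf₂.mono (by decide)).trans (hf₃.mono (by decide))
  refine ⟨by omega, by simp, by omega, by simp, X, Y, ⟨hG₁.frame hf₃' (by decide) (by decide),
    hX.frame hf₃' (by decide), hY.frame hf₃' (by decide), ?_, ?_, ?_, ?_⟩, hle, hXY⟩
  · rw [hf₃ 12 (by decide), h12]
  · rw [hf₃ 13 (by decide), h13]
  · simp [update_apply]
  · simp [update_apply]

theorem wp_round {j : ℕ} (hB : n * n + 5 * n + 1 < B) (h : Invariant G X Y j σ)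
    (hj : Open X Y j) : Wp B round (Invariant G X Y (j + 1)) σ := by
  classical
  have hlt := two_pow_rank_lt (by omega) X Y (v := n) (B := B) le_rfl
  rw [rank_self, rank_self] at hlt
  obtain ⟨hj₁, hj₂⟩ := hj
  have hansw : ∀ τ : Store, τ (4, 0) =
      (if Solves G X Y (G.grown X Y (j * 2 ^ (free X Y).card)) then 1
        else if Solves G X Y (bitSet X Y j) then 1 else σ (4, 0)) →
      τ (4, 0) = if ∃ i < j + 1, Hit G X Y i then 1 else 0 := by
    intro τ hτ
    have hsucc : (∃ i < j + 1, Hit G X Y i) ↔ (∃ i < j, Hit G X Y i) ∨ Hit G X Y j := by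
      constructor
      · rintro ⟨i, hi, hh⟩
        rcases Nat.lt_succ_iff_lt_or_eq.1 hi with hi | rfl
        · exact .inl ⟨i, hi, hh⟩
        · exact .inr hh
      · rintro (⟨i, hi, hh⟩ | hh)
        · exact ⟨i, by omega, hh⟩
        · exact ⟨j, by omega, hh⟩
    rw [hτ, h.answer]
    obtain ⟨p, hp⟩ : ∃ p : Prop, (∃ i < j, Hit G X Y i) ↔ p := ⟨_, Iff.rfl⟩
    simp only [hsucc, hp]
    unfold Hit
    split_ifs <;> tauto
  rw [round, wp_seq]
  refine wp_decode (by omega) h.graph h.fst h.snd (by rw [h.index]; omega) ?_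
  intro τ₁ hf₁ hA₁
  rw [h.index] at hA₁
  have hG₁ : HasGraph G τ₁ := h.graph.frame hf₁ (by decide) (by decide)
  have hX₁ : Ind τ₁ 5 X := h.fst.frame hf₁ (by decide)
  have hY₁ : Ind τ₁ 6 Y := h.snd.frame hf₁ (by decide)
  rw [wp_seq]
  refine wp_test (by omega) hG₁ hX₁ hY₁ hA₁ ?_
  intro τ₂ hf₂ ho₂
  rw [hf₁ 4 (by decide)] at ho₂
  have hG₂ : HasGraph G τ₂ := hG₁.frame hf₂ (by decide) (by decide)
  have hX₂ : Ind τ₂ 5 X := hX₁.frame hf₂ (by decide)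
  have hY₂ : Ind τ₂ 6 Y := hY₁.frame hf₂ (by decide)
  have h12 : τ₂ (12, 0) = 2 ^ (free X Y).card := by
    rw [hf₂ 12 (by decide), hf₁ 12 (by decide), h.sets]
  have h13 : τ₂ (13, 0) = 9 ^ X.card * 3 ^ (free X Y).card := by
    rw [hf₂ 13 (by decide), hf₁ 13 (by decide), h.length]
  have h14 : τ₂ (14, 0) = j := by
    rw [hf₂ 14 (by decide), hf₁ 14 (by decide), h.index]
  rw [wp_seq]
  refine wp_search (by omega) hG₂ hX₂ hY₂ (by rw [h12, h14]; omega) h13 (by rw [h13]; omega) ?_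
  intro τ₃ hf₃ hA₃
  rw [h12, h14] at hA₃
  have hG₃ : HasGraph G τ₃ := hG₂.frame hf₃ (by decide) (by decide)
  have hX₃ : Ind τ₃ 5 X := hX₂.frame hf₃ (by decide)
  have hY₃ : Ind τ₃ 6 Y := hY₂.frame hf₃ (by decide)
  rw [wp_seq]
  refine wp_test (by omega) hG₃ hX₃ hY₃ hA₃ ?_
  intro τ₄ hf₄ ho₄
  rw [hf₃ 4 (by decide), ho₂] at ho₄
  have h14' : τ₄ (14, 0) = j := by rw [hf₄ 14 (by decide), hf₃ 14 (by decide), h14]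
  rw [wp_put, eval_add, eval_var, eval_lit, h14']
  refine ⟨by omega, by omega, ?_⟩
  have hf₅ : Frame [14] τ₄ (τ₄.update (14, 0) (j + 1)) :=
    (Frame.refl _ τ₄).update (by decide) _ _
  have hf₅' : Frame [4, 9, 11, 14, 20, 21, 22, 23] τ₃ (τ₄.update (14, 0) (j + 1)) :=
    (hf₄.mono (by decide)).trans (hf₅.mono (by decide))
  refine ⟨hG₃.frame hf₅' (by decide) (by decide), hX₃.frame hf₅' (by decide),
    hY₃.frame hf₅' (by decide), ?_, ?_, ?_, hansw _ ?_⟩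
  · rw [hf₅' 12 (by decide), hf₃ 12 (by decide), h12]
  · rw [hf₅' 13 (by decide), hf₃ 13 (by decide), h13]
  · simp [update_apply]
  · rw [hf₅ 4 (by decide), ho₄]

/-- The main loop ends at the first number at which one of the two methods is exhausted. -/
theorem runs_loop (hB : n * n + 5 * n + 1 < B) (m j : ℕ) (hm : 2 ^ (free X Y).card ≤ j + m)
    (hσ : Bounded B σ) (h : Invariant G X Y j σ) :
    ∃ J ≥ j, (∀ i, j ≤ i → i < J → Open X Y i) ∧ ¬ Open X Y J ∧ ∃ σ' t s,
      Runs (.loop bounds round) σ σ' t s ∧ Invariant G X Y J σ' ∧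
      t ≤ (J - j + 1) * (bounds.costBound.eval B + 1 + round.timeBound.eval B) ∧
      s ≤ spaceBound.eval B := by
  have hcost := bounds.cost_le hσ
  by_cases hj : Open X Y j
  swap
  · refine ⟨j, le_rfl, fun i _ _ => by omega, hj, σ, _, _,
      .loop_done (not_not.1 ((eval_bounds h).not.2 hj)), h, ?_, hσ.space_le⟩
    rw [Nat.sub_self, zero_add, one_mul]
    omega
  induction m generalizing j σ with
  | zero => exact absurd hj.1 (by omega)
  | succ m ih =>
    obtain ⟨τ, hex, hinv⟩ := wp_round hB h hj
    obtain ⟨hτ, t, s, hr, ht, hs⟩ := hex.runs (by decide) hσ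
    by_cases hj' : Open X Y (j + 1)
    · obtain ⟨J, hJ, hop, hJo, σ', t', s', hr', hinv', ht', hs'⟩ :=
        ih (j + 1) (by omega) hτ hinv (bounds.cost_le hτ) hj'
      refine ⟨J, by omega, fun i hi hi' => ?_, hJo, σ', _, _,
        .loop_step ((eval_bounds h).2 hj) hr hr', hinv', ?_, max_le hs hs'⟩
      · rcases hi.eq_or_lt with rfl | hi
        · exact hj
        · exact hop i hi hi'
      · rw [show J - j + 1 = (J - (j + 1) + 1) + 1 by omega, Nat.add_mul _ 1]
        omega
    · have hcost' := bounds.cost_le hτ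
      refine ⟨j + 1, by omega, fun i hi hi' => ?_, hj', τ, _, _,
        .loop_step ((eval_bounds h).2 hj) hr
          (.loop_done (not_not.1 ((eval_bounds hinv).not.2 hj'))), hinv, ?_,
        max_le hs hτ.space_le⟩
      · obtain rfl : i = j := by omega
        exact hj
      · rw [show j + 1 - j + 1 = 2 by omega]
        omega

/-- A number at which one of the two methods is exhausted is large enough to decide the problem. -/
theorem exists_hit_iff (hXY : Disjoint X Y) {J : ℕ} (hJ : ¬ Open X Y J) :
    (∃ i < J, Hit G X Y i) ↔ ∃ A, Solves G X Y A := by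
  constructor
  · rintro ⟨i, -, h | h⟩
    · exact ⟨_, h⟩
    · exact ⟨_, h⟩
  · rintro ⟨A, hA⟩
    rw [Open, not_and_or, not_lt, not_lt] at hJ
    rcases hJ with hJ | hJ
    · obtain ⟨j, hj, e⟩ := exists_bitSet_eq (Y := Y) hA.1.1 (Finset.disjoint_left.2
        fun v hv hvY => Finset.mem_compl.1 (hA.2.1 hvY) hv)
      exact ⟨j, by omega, .inl (e.symm ▸ hA)⟩
    · obtain ⟨j, hj, h⟩ := exists_joined_grown hXY hA.1 hA.2
      exact ⟨j, Nat.lt_of_mul_lt_mul_right (hj.trans_le hJ), .inr h⟩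

/-- The number of rounds is `O(3 ^ (n / 2))`: a number below both bounds is below their geometric
mean. -/
theorem sq_le_of_open (hXY : Disjoint X Y) (hle : X.card ≤ Y.card) {j : ℕ} (hj : Open X Y j) :
    j ^ 2 ≤ 3 ^ n := by
  have hcard : X.card + Y.card + (free X Y).card = n := by
    have h := Finset.card_compl (X ∪ Y)
    rw [Fintype.card_fin] at h
    have h' := Finset.card_le_univ (X ∪ Y)
    rw [Fintype.card_fin] at h'
    rw [free, h, ← Finset.card_union_of_disjoint hXY]
    omega
  calc j ^ 2 = j * j := sq j
    _ ≤ j * 2 ^ (free X Y).card := Nat.mul_le_mul_left _ hj.1.le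
    _ ≤ 9 ^ X.card * 3 ^ (free X Y).card := hj.2.le
    _ = 3 ^ (2 * X.card + (free X Y).card) := by
      rw [pow_add, pow_mul]; norm_num
    _ ≤ 3 ^ n := Nat.pow_le_pow_right (by norm_num) (by omega)

section Input

variable (G : SimpleGraph (Fin n)) (Z₁ Z₂ : Finset (Fin n))

theorem hasGraph_input : HasGraph G (input G (Z₁ : Set (Fin n)) Z₂) := by
  constructor
  · simp [input]
  · intro u v
    have : (∃ u' v' : Fin n, u.val * n + v = u' * n + v' ∧ G.Adj u' v') ↔ G.Adj u v := by
      constructor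
      · rintro ⟨u', v', e, h⟩
        obtain ⟨rfl, rfl⟩ := edge_inj e
        exact h
      · exact fun h => ⟨u, v, rfl, h⟩
    rw [input, Finsupp.onFinset_apply, if_neg (by simp)]
    by_cases h : G.Adj u v
    · rw [if_pos ⟨rfl, this.2 h⟩, if_pos h]
    · rw [if_neg (fun h' => h (this.1 h'.2)), if_neg (by simp), if_neg (by simp), if_neg h]

theorem ind_input_fst : Ind (input G (Z₁ : Set (Fin n)) Z₂) 2 Z₁ := by
  intro v
  simp [input, Fin.val_inj]

theorem ind_input_snd : Ind (input G (Z₁ : Set (Fin n)) Z₂) 3 Z₂ := by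
  intro v
  simp [input, Fin.val_inj]

theorem bounded_input (hB : n * n + n + 1 < B) :
    Bounded B (input G (Z₁ : Set (Fin n)) Z₂) := by
  intro k i
  constructor
  · have : B < 2 ^ B := Nat.lt_two_pow_self
    simp only [input, Finsupp.onFinset_apply]
    split_ifs <;> omega
  · intro h
    have := Finsupp.support_onFinset_subset (Finsupp.mem_support_iff.2 h)
    simp only [Finset.mem_product, Finset.mem_range] at this
    omega

end Input

end RAM

theorem mainTheorem2 :
    ∃ (P : RAM.Program) (p q : Polynomial ℕ),
      ∀ (n : ℕ) (G : SimpleGraph (Fin n)) (Z₁ Z₂ : Set (Fin n)),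
        G.Preconnected → Disjoint Z₁ Z₂ →
        ∃ (σ : RAM.Store) (t s : ℕ),
          RAM.Runs P (RAM.input G Z₁ Z₂) σ t s ∧
          (G.TwoDisjointConnected Z₁ Z₂ → RAM.output σ = 1) ∧
          (¬ G.TwoDisjointConnected Z₁ Z₂ → RAM.output σ = 0) ∧
          (t : ℝ) ≤ ((p.eval n : ℕ) : ℝ) * (1.7804 : ℝ) ^ n ∧
          s ≤ q.eval n := by
  classical
  let bound : Polynomial ℕ := .X ^ 2 + 5 * .X + 2
  let loopBound : Polynomial ℕ := RAM.bounds.costBound + 1 + RAM.round.timeBound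
  refine ⟨RAM.solve, (RAM.prepare.timeBound + 3 * loopBound).comp bound,
    RAM.spaceBound.comp bound, ?_⟩
  intro n G Z₁ Z₂ hG hd
  lift Z₁ to Finset (Fin n) using Set.toFinite _
  lift Z₂ to Finset (Fin n) using Set.toFinite _
  rw [Finset.disjoint_coe] at hd
  have hbound : bound.eval n = n * n + 5 * n + 2 := by
    simp [bound, sq]
  have hσ := RAM.bounded_input G Z₁ Z₂ (B := bound.eval n) (by omega)
  obtain ⟨τ, hex, X, Y, hinv, hle, hXY⟩ := RAM.wp_prepare (B := bound.eval n) (by nlinarith)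
    (RAM.hasGraph_input G Z₁ Z₂) (RAM.ind_input_fst G Z₁ Z₂) (RAM.ind_input_snd G Z₁ Z₂)
  obtain ⟨hτ, t, s, hr, ht, hs⟩ := hex.runs (by decide) hσ
  obtain ⟨J, -, hop, hJ, σ, t', s', hr', hinv', ht', hs'⟩ :=
    RAM.runs_loop (by omega) _ 0 (Nat.le_add_left _ _) hτ hinv
  have hd' : Disjoint X Y := by
    rcases hXY with ⟨rfl, rfl⟩ | ⟨rfl, rfl⟩
    · exact hd
    · exact hd.symm
  have hiff : G.TwoDisjointConnected Z₁ Z₂ ↔ ∃ i < J, RAM.Hit G X Y i := by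
    rw [RAM.exists_hit_iff hd' hJ]
    rcases hXY with ⟨rfl, rfl⟩ | ⟨rfl, rfl⟩
    · exact SimpleGraph.twoDisjointConnected_iff_exists_joined hG _ _
    · rw [SimpleGraph.twoDisjointConnected_iff_exists_joined hG]
      constructor
      · rintro ⟨A, h, h'⟩
        exact ⟨Aᶜ, h', by rwa [compl_compl]⟩
      · rintro ⟨A, h, h'⟩
        exact ⟨Aᶜ, h', by rwa [compl_compl]⟩
  refine ⟨σ, t + t', max s s', hr.seq hr', fun h => ?_, fun h => ?_, ?_, ?_⟩
  · rw [RAM.output, hinv'.answer, if_pos (hiff.1 h)]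
  · rw [RAM.output, hinv'.answer, if_neg (hiff.not.1 h)]
  · have hone : (1 : ℝ) ≤ 1.7804 ^ n := one_le_pow₀ (by norm_num)
    have hJle : (J : ℝ) ≤ 1 + 1.7804 ^ n := by
      rcases Nat.eq_zero_or_pos J with rfl | hpos
      · simp only [Nat.cast_zero]
        linarith
      · have hsq := RAM.sq_le_of_open hd' hle (hop (J - 1) (Nat.zero_le _) (by omega))
        have hsq' : ((J - 1 : ℕ) : ℝ) ^ 2 ≤ 3 ^ n := by exact_mod_cast hsq
        have h3 : (3 : ℝ) ^ n ≤ (1.7804 ^ n) ^ 2 := by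
          rw [← pow_mul, mul_comm, pow_mul]
          exact pow_le_pow_left₀ (by norm_num) (by norm_num) n
        have := le_of_sq_le_sq (hsq'.trans h3) (by linarith)
        rw [Nat.cast_sub hpos, Nat.cast_one] at this
        linarith
    rw [Polynomial.eval_comp]
    simp only [Polynomial.eval_add, Polynomial.eval_mul, Polynomial.eval_ofNat, loopBound,
      Polynomial.eval_one]
    generalize RAM.prepare.timeBound.eval (bound.eval n) = a at ht
    rw [Nat.sub_zero] at ht'
    generalize RAM.bounds.costBound.eval (bound.eval n) + 1 +
      RAM.round.timeBound.eval (bound.eval n) = b at ht'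
    have ht₁ : (t : ℝ) ≤ a := by exact_mod_cast ht
    have ht₂ : (t' : ℝ) ≤ (J + 1) * b := by exact_mod_cast ht'
    have hb : (0 : ℝ) ≤ b := Nat.cast_nonneg b
    have ha : (0 : ℝ) ≤ a := Nat.cast_nonneg a
    push_cast
    calc (t : ℝ) + t' ≤ a + (J + 1) * b := add_le_add ht₁ ht₂
      _ ≤ a * 1.7804 ^ n + (3 * 1.7804 ^ n) * b := by
        refine add_le_add (le_mul_of_one_le_right ha hone) (mul_le_mul_of_nonneg_right ?_ hb)
        linarith
      _ = (a + 3 * b) * 1.7804 ^ n := by ring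
  · rw [Polynomial.eval_comp]
    exact max_le hs hs'
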